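/- **Setting.** Let $n\ge 1$, let $\Theta\subseteq\mathbb{R}^n$ be compact and convex, and let the prior $F$ be a probability measure on $\Theta$ that has a strictly positive density on $\Theta$ with respect to Lebesgue measure (so $F$ is atomless). Let $A$ be a compact metric space of actions, and let $u_S,u_R:A\times\Theta\to\mathbb{R}$ be the payoffs of the sender and the receiver. For each $\theta$, $u_S(a,\theta)$ is continuous and $u_R(a,\theta)$ upper semicontinuous in $a$. For each $a$, both payoffs are measurable in $\theta$ and integrable under every belief, and $\sup_a|u_S(a,\theta)|$ is dominated by an $F$-integrable function of $\theta$. A *belief* is an element of $\Delta(\Theta)$, the Borel probability measures on $\Theta$ with the weak$^*$ topology. A *message* is a non-empty closed subset of $\Theta$; the set $\mathcal C$ of messages carries the Hausdorff metric. For a belief $G$ let $a^*(G)=\arg\max_{a\in A}\int u_R(a,\theta)\,dG(\theta)$ and $U_R(G)=\max_{a\in A}\int u_R(a,\theta)\,dG(\theta)$. For a type $\theta$ let $a^*(\theta)\in a^*(\delta_\theta)$ be an optimal action under complete information, with ties broken so as to minimize $u_S(\cdot,\theta)$. Let $\underline a(G)$ and $\overline a(G)$ be elements of $a^*(G)$ that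 respectively minimize and maximize $\int u_S(a,\theta)\,dG(\theta)$ over $a\in a^*(G)$. **Assumptions.** 1. (No rents from full revelation) $u_S(a,\theta)\ge u_S(a^*(\theta),\theta)$ for every type $\theta$, every belief $G$ with $\theta\in\operatorname{supp}G$, and every $a\in a^*(G)$. 2. (Worst-case types) Every message $m$ contains a type $\hat\theta_m$ with $u_S(a^*(\theta),\theta)\ge u_S(a^*(\hat\theta_m),\theta)$ for every $\theta\in m$. 3. (Continuity) (a) $U_R$ is well defined (the maximum is attained) and continuous, and $G\mapsto a^*(G)$ is upper hemicontinuous. (b) For all $\eta,\delta>0$ there are measurable maps $G\mapsto\underline H$ and $G\mapsto\overline H$ from $\Delta(\Theta)$ to itself such that, for every belief $G$, the measures $\underline H,\overline H$ are absolutely continuous with respect to $G$ with $\frac{d\underline H}{dG}\le 1+\eta$ and $\frac{d\overline H}{dG}\le 1+\eta$, every action in $a^*(\underline H)$ is within $\delta$ of $\underline a(G)$, and every action in $a^*(\overline H)$ is within $\delta$ of $\overline a(G)$. **Achievable payoffs.** A *segmentation* is a probability measure $\sigma$ on $\Delta(\Theta)$ with $\int G\,d\sigma(G)=F$. A profile $(u_S^*,u_R^*)$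 is *achievable* if there are a segmentation $\sigma$ and a measurable choice of actions $a(G)$, with $a(G)\in a^*(G)$ for $\sigma$-almost every $G$, such that $u_i^*=\int\!\int u_i(a(G),\theta)\,dG(\theta)\,d\sigma(G)$ for $i=S,R$. **Disclosure game.** The sender learns $\theta\sim F$ and sends a message $m\ni\theta$; the receiver observes $m$ and chooses an action. A *perfect Bayesian equilibrium* consists of a messaging strategy $\rho$ (a Markov kernel from $\Theta$ to $\mathcal C$), a receiver strategy $\tau:\mathcal C\to A$ and beliefs $\mu:\mathcal C\to\Delta(\Theta)$ such that: for every $\theta$, the support of $\rho(\theta)$ is contained in $\arg\max_{m\in\mathcal C,\,m\ni\theta}u_S(\tau(m),\theta)$; for every $m$, $\tau(m)\in a^*(\mu(m))$ and $\operatorname{supp}\mu(m)\subseteq m$; and $\mu$ is a version of the regular conditional distribution of the type given the message under $F$ and $\rho$. Here $\tau$ and $\mu$ are measurable up to a set of messages of probability zero. Its payoffs are the ex ante expectations of $u_S(\tau(m),\theta)$ and $u_R(\tau(m),\theta)$. **Theorem.** Under Assumptions 1, 2 and 3, for every achievable payoff profile $(u_S^*,u_R^*)$ and every $\varepsilon>0$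 there is a perfect Bayesian equilibrium of the disclosure game whose payoffs $(w_S,w_R)$ are well defined and satisfy $|w_S-u_S^*|<\varepsilon$ and $|w_R-u_R^*|<\varepsilon$. -/

import Mathlib

open MeasureTheory ProbabilityTheory Set

namespace Disclosure

/-- Messages over a compact type space: the non-empty closed (equivalently, as the type space is
compact, non-empty compact) subsets, with Mathlib's Hausdorff metric. -/
abbrev Message (T : Type*) [TopologicalSpace T] := TopologicalSpace.NonemptyCompacts T

/-- The Borel sigma-algebra of the Hausdorff metric on messages. -/
instance instMeasurableSpaceMessage {T : Type*} [MetricSpace T] :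
    MeasurableSpace (TopologicalSpace.NonemptyCompacts T) := borel _

instance instBorelSpaceMessage {T : Type*} [MetricSpace T] :
    BorelSpace (TopologicalSpace.NonemptyCompacts T) := ⟨rfl⟩

/-- `a^*(G)`: the receiver's optimal actions at the belief `G`. -/
def bestResponse {T A : Type*} [MeasurableSpace T] (uR : A → T → ℝ)
    (G : ProbabilityMeasure T) : Set A :=
  {a | ∀ b : A, ∫ θ, uR b θ ∂(G : Measure T) ≤ ∫ θ, uR a θ ∂(G : Measure T)}

/-- `U_R(G)`: the receiver's optimal expected payoff at the belief `G`. -/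
noncomputable def optimalPayoff {T A : Type*} [MeasurableSpace T] (uR : A → T → ℝ)
    (G : ProbabilityMeasure T) : ℝ :=
  ⨆ a : A, ∫ θ, uR a θ ∂(G : Measure T)

/-- The belief that is concentrated on the type `θ`. -/
noncomputable def pointBelief {T : Type*} [MeasurableSpace T] (θ : T) : ProbabilityMeasure T :=
  ⟨Measure.dirac θ, inferInstance⟩

/-- Standing conventions on the payoffs: the sender's payoff is continuous and the receiver's is
upper semicontinuous in the action; both are measurable in the type; each action has a
well-defined expected payoff under every belief; and the sender's ex ante expected payoff is
well-defined however actions are matched to types. -/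
structure RegularPayoffs {T A : Type*} [MeasurableSpace T] [TopologicalSpace A]
    (F : ProbabilityMeasure T) (uS uR : A → T → ℝ) : Prop where
  continuous_sender : ∀ θ, Continuous fun a => uS a θ
  upperSemicontinuous_receiver : ∀ θ, UpperSemicontinuous fun a => uR a θ
  measurable_sender : ∀ a, Measurable (uS a)
  measurable_receiver : ∀ a, Measurable (uR a)
  integrable_sender : ∀ a, ∀ G : ProbabilityMeasure T, Integrable (uS a) (G : Measure T)
  integrable_receiver : ∀ a, ∀ G : ProbabilityMeasure T, Integrable (uR a) (G : Measure T)
  envelope_sender : ∃ g : T → ℝ, Integrable g (F : Measure T) ∧ ∀ a θ, |uS a θ| ≤ g θ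

/-- `aStar θ` is an optimal action of the receiver when the type is known to be `θ`, with ties
broken against the sender of type `θ`. -/
def IsCompleteInfoAction {T A : Type*} [MeasurableSpace T] (uS uR : A → T → ℝ)
    (aStar : T → A) : Prop :=
  ∀ θ, aStar θ ∈ bestResponse uR (pointBelief θ) ∧
    ∀ b ∈ bestResponse uR (pointBelief θ), uS (aStar θ) θ ≤ uS b θ

/-- No rents from full revelation. -/
def NoRents {T A : Type*} [TopologicalSpace T] [MeasurableSpace T] (uS uR : A → T → ℝ)
    (aStar : T → A) : Prop :=
  ∀ (θ : T) (G : ProbabilityMeasure T), θ ∈ (G : Measure T).support →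
    ∀ a ∈ bestResponse uR G, uS (aStar θ) θ ≤ uS a θ

/-- Every message contains a worst-case type. -/
def HasWorstCaseTypes {T A : Type*} [TopologicalSpace T] (uS : A → T → ℝ)
    (aStar : T → A) : Prop :=
  ∀ m : Message T, ∃ θhat ∈ m, ∀ θ ∈ m, uS (aStar θhat) θ ≤ uS (aStar θ) θ

/-- `aLow G` is an optimal action at `G` that is worst for the sender among these. -/
def IsSenderWorst {T A : Type*} [MeasurableSpace T] (uS uR : A → T → ℝ)
    (aLow : ProbabilityMeasure T → A) : Prop :=
  ∀ G, aLow G ∈ bestResponse uR G ∧ ∀ b ∈ bestResponse uR G,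
    ∫ θ, uS (aLow G) θ ∂(G : Measure T) ≤ ∫ θ, uS b θ ∂(G : Measure T)

/-- `aHigh G` is an optimal action at `G` that is best for the sender among these. -/
def IsSenderBest {T A : Type*} [MeasurableSpace T] (uS uR : A → T → ℝ)
    (aHigh : ProbabilityMeasure T → A) : Prop :=
  ∀ G, aHigh G ∈ bestResponse uR G ∧ ∀ b ∈ bestResponse uR G,
    ∫ θ, uS b θ ∂(G : Measure T) ≤ ∫ θ, uS (aHigh G) θ ∂(G : Measure T)

/-- Beliefs can be perturbed, measurably and with densities at most `1 + ε`, so that every optimal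
action becomes `δ`-close to `sel`. -/
def CanPerturbTo {T A : Type*} [MeasurableSpace T] [MetricSpace A] (uR : A → T → ℝ)
    (sel : ProbabilityMeasure T → A) : Prop :=
  ∀ ε : ℝ, 0 < ε → ∀ δ : ℝ, 0 < δ → ∃ t : ProbabilityMeasure T → ProbabilityMeasure T,
    Measurable t ∧ ∀ G : ProbabilityMeasure T,
      (t G : Measure T) ≪ (G : Measure T) ∧
      (∀ᵐ θ ∂(G : Measure T),
        (t G : Measure T).rnDeriv (G : Measure T) θ ≤ ENNReal.ofReal (1 + ε)) ∧
      bestResponse uR (t G) ⊆ Metric.ball (sel G) δ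

/-- The continuity conditions. The first clause says that the maximum defining `U_R` is attained. -/
structure ContinuityConditions {T A : Type*} [TopologicalSpace T] [MeasurableSpace T]
    [OpensMeasurableSpace T] [MetricSpace A] (uS uR : A → T → ℝ) : Prop where
  nonempty_bestResponse : ∀ G : ProbabilityMeasure T, (bestResponse uR G).Nonempty
  continuous_optimalPayoff : Continuous fun G : ProbabilityMeasure T => optimalPayoff uR G
  upperHemicontinuous_bestResponse :
    UpperHemicontinuous fun G : ProbabilityMeasure T => bestResponse uR G
  perturb_low : ∃ aLow : ProbabilityMeasure T → A, IsSenderWorst uS uR aLow ∧ CanPerturbTo uR aLow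
  perturb_high : ∃ aHigh : ProbabilityMeasure T → A,
    IsSenderBest uS uR aHigh ∧ CanPerturbTo uR aHigh

/-- A segmentation: a distribution over beliefs that average to the prior. (Mathlib's
sigma-algebra on beliefs is generated by the evaluations `G ↦ G B`; on a compact metric space it is
the Borel sigma-algebra of the weak topology.) -/
def IsSegmentation {T : Type*} [MeasurableSpace T] (F : ProbabilityMeasure T)
    (σ : ProbabilityMeasure (ProbabilityMeasure T)) : Prop :=
  ∀ B : Set T, MeasurableSet B →
    ∫⁻ G, (G : Measure T) B ∂(σ : Measure (ProbabilityMeasure T)) = (F : Measure T) B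

/-- The payoff profile `(vS, vR)` is achieved by some segmentation `σ` together with best
responses `a` of the receiver. -/
def Achievable {T A : Type*} [MeasurableSpace T] [MeasurableSpace A]
    (F : ProbabilityMeasure T) (uS uR : A → T → ℝ) (vS vR : ℝ) : Prop :=
  ∃ (σ : ProbabilityMeasure (ProbabilityMeasure T)) (a : ProbabilityMeasure T → A),
    IsSegmentation F σ ∧
    AEMeasurable a (σ : Measure (ProbabilityMeasure T)) ∧
    (∀ᵐ G ∂(σ : Measure (ProbabilityMeasure T)), a G ∈ bestResponse uR G) ∧
    Integrable (fun G : ProbabilityMeasure T => ∫ θ, uS (a G) θ ∂(G : Measure T))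
      (σ : Measure (ProbabilityMeasure T)) ∧
    Integrable (fun G : ProbabilityMeasure T => ∫ θ, uR (a G) θ ∂(G : Measure T))
      (σ : Measure (ProbabilityMeasure T)) ∧
    ∫ G, (∫ θ, uS (a G) θ ∂(G : Measure T)) ∂(σ : Measure (ProbabilityMeasure T)) = vS ∧
    ∫ G, (∫ θ, uR (a G) θ ∂(G : Measure T)) ∂(σ : Measure (ProbabilityMeasure T)) = vR

/-- The messages that are optimal for the sender of type `θ` among those that contain `θ`, when the
receiver plays `τ`. -/
def optimalMessages {T A : Type*} [TopologicalSpace T] (uS : A → T → ℝ)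
    (τ : Message T → A) (θ : T) : Set (Message T) :=
  {m | θ ∈ m ∧ ∀ m' : Message T, θ ∈ m' → uS (τ m') θ ≤ uS (τ m) θ}

/-- The joint law of the type and the message. -/
noncomputable def jointLaw {T : Type*} [MetricSpace T] [MeasurableSpace T]
    (F : ProbabilityMeasure T) (ρ : Kernel T (Message T)) : Measure (T × Message T) :=
  (F : Measure T) ⊗ₘ ρ

/-- Perfect Bayesian equilibrium of the disclosure game: the sender uses the messaging strategy
`ρ`, the receiver the strategy `τ` and the belief system `μ`. -/
structure IsEquilibrium {T A : Type*} [MetricSpace T] [MeasurableSpace T] [MeasurableSpace A]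
    (F : ProbabilityMeasure T) (uS uR : A → T → ℝ) (ρ : Kernel T (Message T))
    (τ : Message T → A) (μ : Message T → ProbabilityMeasure T) : Prop where
  isMarkovKernel : IsMarkovKernel ρ
  aemeasurable_receiver : AEMeasurable τ (jointLaw F ρ).snd
  messages_feasible : ∀ θ, (ρ θ).support ⊆ {m | θ ∈ m}
  sender_optimal : ∀ θ, (ρ θ).support ⊆ optimalMessages uS τ θ
  receiver_optimal : ∀ m, τ m ∈ bestResponse uR (μ m)
  beliefs_respect_evidence : ∀ m : Message T, (μ m : Measure T).support ⊆ (m : Set T)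
  /-- `μ` is a regular conditional distribution of the type given the message. -/
  bayes : ∃ κ : Kernel (Message T) T, IsMarkovKernel κ ∧
    (jointLaw F ρ).snd ⊗ₘ κ = (jointLaw F ρ).map Prod.swap ∧
    ∀ᵐ m ∂(jointLaw F ρ).snd, κ m = (μ m : Measure T)

/-- The payoff profile `(vS, vR)` is the pair of ex ante expected payoffs of some equilibrium. -/
def Supportable {T A : Type*} [MetricSpace T] [MeasurableSpace T] [MeasurableSpace A]
    (F : ProbabilityMeasure T) (uS uR : A → T → ℝ) (vS vR : ℝ) : Prop :=
  ∃ (ρ : Kernel T (Message T)) (τ : Message T → A) (μ : Message T → ProbabilityMeasure T),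
    IsEquilibrium F uS uR ρ τ μ ∧
    Integrable (fun p : T × Message T => uS (τ p.2) p.1) (jointLaw F ρ) ∧
    Integrable (fun p : T × Message T => uR (τ p.2) p.1) (jointLaw F ρ) ∧
    ∫ p, uS (τ p.2) p.1 ∂(jointLaw F ρ) = vS ∧
    ∫ p, uR (τ p.2) p.1 ∂(jointLaw F ρ) = vR

end Disclosure

/-!
Why every achievable profile is almost an equilibrium payoff profile.

*From messages to equilibria.* Suppose that countably many disjoint closed messages cover almost all
types, each of them being the support of the prior conditional on it. Let the types in a message
send it, let the remaining (null) types reveal themselves, and let the receiver answer an on-path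
message by any best response to the prior conditional on it. An off-path message is attributed to
its worst-case type. By the choice of that type a deviation yields at most the payoff under full
revelation, and since a type in an on-path message is in the support of the induced belief, the
no-rents assumption gives it at least that payoff on path. So this is an equilibrium
(`exists_supportable_of_messages`).

*From finite mixtures to messages.* Let `∑ k, c k • H k ≤ F` be a finite mixture of beliefs. As `F`
is atomless, each cell of a fine grid of the type space can be cut into disjoint pieces whose
`F`-masses are those that the measures `c k • H k` give to the cell; the union of the `k`-th pieces
over all cells then induces a belief that is weakly close to `H k`. Inner regularity makes these
sets closed, and passing to the support of the restricted prior makes them self-supporting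
(`exists_disjoint_messages`). The types that are left over are exhausted by countably many further
closed messages, which have little total mass. If all best responses to `H k` are close to one
action `α k`, then by upper hemicontinuity so are those to nearby beliefs; thus the payoffs of the
resulting equilibrium are close to those of the mixture (`exists_supportable_of_finite`).

*From segmentations to finite mixtures.* Any measurable family of beliefs with nearly unique best
responses can be partitioned into countably many measurable parts on which beliefs lie in a small
weak neighbourhood that is stable under averaging. Averaging over finitely many of these parts gives
a finite mixture with almost the same payoffs (`exists_finite_mixture`).

*Enforcing the action rule.* In an achievable profile the receiver breaks ties arbitrarily, but the
sender's payoff is a convex combination of those under the sender-worst and the sender-best rules,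
and the receiver's payoff does not depend on the rule. By the continuity assumption, either rule is
enforced up to a small distance by beliefs whose densities with respect to the original ones are at
most `1 + η`. Weighting the two perturbed segmentations by the coefficients of the convex
combination, divided by `1 + η`, gives a family of beliefs whose mixture is dominated by the prior
(`comp_sumElim_le`) and whose mass is close to one.

The sender's payoff need not be jointly continuous. It is, however, an integrable function from
types to the space `C(A, ℝ)`, so it is close in mean to a continuous one
(`exists_continuous_sender_approx`). All closeness estimates are carried out for that
approximation; its error is controlled because the segmentation and the equilibrium beliefs
average to the prior.
-/

open Filter Topology
open scoped ENNReal NNReal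

namespace Disclosure

/-! ### Beliefs and their weak neighbourhoods -/

section BeliefKernel

variable {T : Type*} [MeasurableSpace T]

/-- A measurable family of beliefs, as a Markov kernel. -/
noncomputable def beliefKernel {Ω : Type*} [MeasurableSpace Ω] (H : Ω → ProbabilityMeasure T)
    (hH : Measurable H) : Kernel Ω T :=
  ⟨fun ω => (H ω : Measure T), measurable_subtype_coe.comp hH⟩

lemma beliefKernel_apply {Ω : Type*} [MeasurableSpace Ω] (H : Ω → ProbabilityMeasure T)
    (hH : Measurable H) (ω : Ω) : beliefKernel H hH ω = (H ω : Measure T) := rfl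

instance {Ω : Type*} [MeasurableSpace Ω] (H : Ω → ProbabilityMeasure T)
    (hH : Measurable H) : IsMarkovKernel (beliefKernel H hH) :=
  ⟨fun ω => by rw [beliefKernel_apply]; infer_instance⟩

lemma measurable_integral_belief {Ω : Type*} [MeasurableSpace Ω] {H : Ω → ProbabilityMeasure T}
    (hH : Measurable H) {f : Ω → T → ℝ} (hf : Measurable (Function.uncurry f)) :
    Measurable fun ω => ∫ x, f ω x ∂(H ω : Measure T) :=
  (StronglyMeasurable.integral_kernel_prod_right (κ := beliefKernel H hH)
    hf.stronglyMeasurable).measurable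

end BeliefKernel

section Beliefs

variable {T : Type*} [MetricSpace T] [MeasurableSpace T]

/-- The beliefs whose integrals of the finitely many test functions in `s` differ from those of
`G₀` by at most `r`. These sets form a neighbourhood basis of `G₀` in the weak topology, and are
stable under averaging. -/
def testBall (s : Finset C(T, ℝ)) (r : ℝ) (G₀ : ProbabilityMeasure T) :
    Set (ProbabilityMeasure T) :=
  {G | ∀ f ∈ s, |∫ x, f x ∂(G : Measure T) - ∫ x, f x ∂(G₀ : Measure T)| ≤ r}

lemma testBall_eq_biInter (s : Finset C(T, ℝ)) (r : ℝ) (G₀ : ProbabilityMeasure T) :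
    testBall s r G₀ = ⋂ f ∈ s, {G : ProbabilityMeasure T |
      |∫ x, f x ∂(G : Measure T) - ∫ x, f x ∂(G₀ : Measure T)| ≤ r} := by
  ext; simp [testBall]

variable [BorelSpace T]

/-- The weak topology on beliefs is induced by the integrals of continuous functions. -/
lemma exists_testBall_subset {G₀ : ProbabilityMeasure T}
    {U : Set (ProbabilityMeasure T)} (hU : U ∈ 𝓝 G₀) :
    ∃ (s : Finset C(T, ℝ)) (r : ℝ), 0 < r ∧ testBall s r G₀ ⊆ U := by
  classical
  let I : ProbabilityMeasure T → C(T, ℝ) → ℝ := fun G f => ∫ x, f x ∂(G : Measure T)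
  have hle : comap I (𝓝 (I G₀)) ≤ 𝓝 G₀ := by
    have : Tendsto (id : ProbabilityMeasure T → _) (comap I (𝓝 (I G₀))) (𝓝 G₀) := by
      rw [ProbabilityMeasure.tendsto_iff_forall_integral_tendsto]
      intro f
      have h := (tendsto_pi_nhds.1 (tendsto_comap (f := I) (x := 𝓝 (I G₀)))) f.toContinuousMap
      exact h
    exact this
  obtain ⟨V, hV, hVU⟩ := mem_comap.1 (hle hU)
  rw [nhds_pi, Filter.mem_pi] at hV
  obtain ⟨J, hJ, t, ht, htV⟩ := hV
  have : ∀ f : C(T, ℝ), ∃ r > 0, Metric.closedBall (I G₀ f) r ⊆ t f := fun f =>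
    Metric.nhds_basis_closedBall.mem_iff.1 (ht f)
  choose r hr hrt using this
  rcases hJ.toFinset.eq_empty_or_nonempty with h | h
  · refine ⟨∅, 1, one_pos, fun G _ => hVU (htV ?_)⟩
    have : J = ∅ := by simpa using h
    simp [this]
  · refine ⟨hJ.toFinset, hJ.toFinset.inf' h r, by simpa using fun i _ => hr i, fun G hG => ?_⟩
    refine hVU (htV fun f hf => hrt f ?_)
    have h1 := hG f (by simpa using hf)
    rw [Metric.mem_closedBall, Real.dist_eq]
    exact h1.trans (Finset.inf'_le _ (by simpa using hf))

lemma measurableSet_testBall (s : Finset C(T, ℝ)) (r : ℝ) (G₀ : ProbabilityMeasure T) :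
    MeasurableSet (testBall s r G₀) := by
  rw [testBall_eq_biInter]
  refine Finset.measurableSet_biInter _ fun f _ => ?_
  have hm : Measurable fun G : ProbabilityMeasure T => ∫ x, f x ∂(G : Measure T) :=
    measurable_integral_belief measurable_id
      (f := fun _ x => f x) ((map_continuous f).measurable.comp measurable_snd)
  exact measurableSet_le ((hm.sub_const _).abs) measurable_const

variable [CompactSpace T]

lemma integrable_continuousMap (f : C(T, ℝ)) (μ : Measure T) [IsFiniteMeasure μ] :
    Integrable (fun x => f x) μ := by
  have := (map_continuous f).integrable_of_hasCompactSupport (μ := μ)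
    (HasCompactSupport.of_compactSpace _)
  exact this

lemma testBall_mem_nhds (s : Finset C(T, ℝ)) {r : ℝ} (hr : 0 < r) (G₀ : ProbabilityMeasure T) :
    testBall s r G₀ ∈ 𝓝 G₀ := by
  rw [testBall_eq_biInter, Filter.biInter_finset_mem]
  intro f _
  have hc : Continuous fun G : ProbabilityMeasure T =>
      |∫ x, f x ∂(G : Measure T) - ∫ x, f x ∂(G₀ : Measure T)| :=
    ((ProbabilityMeasure.continuous_integral_continuousMap f).sub continuous_const).abs
  exact hc.continuousAt.preimage_mem_nhds (Iic_mem_nhds (by simpa using hr))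

/-- The evaluation sigma-algebra on beliefs contains every weakly open set. -/
instance instOpensMeasurableSpaceBelief : OpensMeasurableSpace (ProbabilityMeasure T) := by
  refine ⟨MeasurableSpace.generateFrom_le fun U hU => ?_⟩
  have hU : IsOpen U := hU
  choose! s r hr hsr using fun (G : ProbabilityMeasure T) (hG : G ∈ U) =>
    exists_testBall_subset (hU.mem_nhds hG)
  obtain ⟨t, htU, htc, ht⟩ := TopologicalSpace.countable_cover_nhdsWithin
    (f := fun G => testBall (s G) (r G) G)
    fun G hG => mem_nhdsWithin_of_mem_nhds (testBall_mem_nhds (s G) (hr G hG) G)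
  have hUeq : U = ⋃ G ∈ t, testBall (s G) (r G) G :=
    Subset.antisymm ht (iUnion₂_subset fun G hG => hsr G (htU hG))
  rw [hUeq]
  exact MeasurableSet.biUnion htc fun G _ => measurableSet_testBall _ _ _

end Beliefs

/-! ### Cutting atomless measures -/

section Atomless

/-- A finite atomless measure on a standard Borel space takes every value between zero and the
measure of a given set on a subset of it. -/
lemma exists_measurableSet_subset_measure_eq {T : Type*} [MeasurableSpace T] [StandardBorelSpace T]
    (μ : Measure T) [IsFiniteMeasure μ] [NullSingletonClass μ] {C : Set T}
    (hC : MeasurableSet C) {r : ℝ≥0∞} (hr : r ≤ μ C) : ∃ B ⊆ C, MeasurableSet B ∧ μ B = r := by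
  obtain ⟨e, he⟩ := exists_measurableEmbedding_real T
  let ν : Measure ℝ := (μ.restrict C).map e
  have hν : ∀ s : Set ℝ, MeasurableSet s → ν s = μ (e ⁻¹' s ∩ C) := fun s hs => by
    rw [he.map_apply, Measure.restrict_apply (he.measurable hs)]
  have : IsFiniteMeasure ν := by infer_instance
  have hat : ∀ x, ν {x} = 0 := by
    intro x
    rw [hν _ (measurableSet_singleton x)]
    have hsub : (e ⁻¹' {x} ∩ C).Subsingleton := fun a ha b hb =>
      he.injective ((ha.1 : e a = x).trans (hb.1 : e b = x).symm)
    exact hsub.measure_zero μ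
  have : NullSingletonClass ν := ⟨hat⟩
  suffices ∃ s : Set ℝ, MeasurableSet s ∧ ν s = r by
    obtain ⟨s, hs, h⟩ := this
    exact ⟨e ⁻¹' s ∩ C, inter_subset_right, (he.measurable hs).inter hC, by rw [← h, hν s hs]⟩
  have htot : ν univ = μ C := by rw [hν _ MeasurableSet.univ]; simp
  rcases eq_or_ne r 0 with rfl | h0
  · exact ⟨∅, MeasurableSet.empty, by simp⟩
  rcases hr.eq_or_lt with rfl | hlt
  · exact ⟨univ, MeasurableSet.univ, htot⟩
  have hfin : r ≠ ∞ := hlt.ne_top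
  have hbot : Tendsto (fun t => ν.real (Iic t)) atBot (𝓝 0) := by
    have h := (ENNReal.tendsto_toReal (measure_ne_top ν univ)).comp (tendsto_measure_Ici_atBot ν)
    have h2 : (fun t => ν.real (Iic t)) = fun t => ν.real univ - ν.real (Ici t) := by
      ext t
      rw [← measureReal_compl measurableSet_Ici, compl_Ici, measureReal_congr Iio_ae_eq_Iic]
    rw [h2]
    have h3 := h.const_sub (ν.real univ)
    rwa [show ν.real univ - (ν univ).toReal = 0 from sub_self _] at h3
  have htop : Tendsto (fun t => ν.real (Iic t)) atTop (𝓝 (μ C).toReal) := by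
    have h := tendsto_measure_Iic_atTop ν
    rw [htot] at h
    exact (ENNReal.tendsto_toReal (measure_ne_top μ C)).comp h
  have hcont : Continuous fun t => ν.real (Iic t) := by
    have h1 : Continuous fun t => ∫ _ in (0:ℝ)..t, (1:ℝ) ∂ν :=
      intervalIntegral.continuous_primitive (fun a b => intervalIntegrable_const) 0
    have h2 : (fun t => ν.real (Iic t)) = fun t => ν.real (Iic 0) + ∫ _ in (0:ℝ)..t, (1:ℝ) ∂ν := by
      ext t
      have h3 := intervalIntegral.integral_Iic_sub_Iic (μ := ν) (f := fun _ => (1:ℝ)) (a := 0)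
        (b := t) (integrable_const _).integrableOn (integrable_const _).integrableOn
      rw [← h3]
      simp
    rw [h2]
    exact continuous_const.add h1
  have hmem : r.toReal ∈ Ioo 0 (μ C).toReal :=
    ⟨ENNReal.toReal_pos h0 hfin, (ENNReal.toReal_lt_toReal hfin (measure_ne_top μ C)).2 hlt⟩
  obtain ⟨a, ha⟩ := (hbot.eventually (gt_mem_nhds hmem.1)).exists
  obtain ⟨b, hb⟩ := (htop.eventually (lt_mem_nhds hmem.2)).exists
  obtain ⟨t, ht⟩ := mem_range_of_exists_le_of_exists_ge hcont ⟨a, ha.le⟩ ⟨b, hb.le⟩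
  refine ⟨Iic t, measurableSet_Iic, ?_⟩
  exact (ENNReal.toReal_eq_toReal_iff' (measure_ne_top _ _) hfin).1 ht

/-- A set can be cut into finitely many disjoint pieces of prescribed atomless measures. -/
lemma exists_pairwiseDisjoint_measure_eq {T : Type*} [MeasurableSpace T] [StandardBorelSpace T]
    (μ : Measure T) [IsFiniteMeasure μ] [NullSingletonClass μ] {ι : Type*} (s : Finset ι)
    (r : ι → ℝ≥0∞) {C : Set T} (hC : MeasurableSet C) (hr : ∑ k ∈ s, r k ≤ μ C) :
    ∃ B : ι → Set T, (∀ k ∈ s, B k ⊆ C ∧ MeasurableSet (B k) ∧ μ (B k) = r k) ∧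
      (s : Set ι).PairwiseDisjoint B := by
  classical
  induction s using Finset.induction_on generalizing C with
  | empty => exact ⟨fun _ => ∅, by simp, by simp⟩
  | insert i s his ih =>
    rw [Finset.sum_insert his] at hr
    obtain ⟨D, hDC, hD, hDr⟩ := exists_measurableSet_subset_measure_eq μ hC (le_self_add.trans hr)
    have hri : r i ≠ ∞ := by rw [← hDr]; exact measure_ne_top _ _
    have hr' : ∑ k ∈ s, r k ≤ μ (C \ D) := by
      rw [measure_sdiff hDC hD.nullMeasurableSet (measure_ne_top _ _), hDr]
      exact ENNReal.le_sub_of_add_le_left hri hr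
    obtain ⟨B, hB, hdisj⟩ := ih (hC.diff hD) hr'
    have hne : ∀ k ∈ s, k ≠ i := fun k hk h => his (h ▸ hk)
    refine ⟨Function.update B i D, ?_, ?_⟩
    · intro k hk
      rcases Finset.mem_insert.1 hk with rfl | hk
      · simpa using ⟨hDC, hD, hDr⟩
      · rw [Function.update_of_ne (hne k hk)]
        exact ⟨(hB k hk).1.trans sdiff_subset, (hB k hk).2⟩
    · rw [Finset.coe_insert, Set.pairwiseDisjoint_insert]
      refine ⟨fun k hk l hl hkl => ?_, fun k hk hki => ?_⟩
      · simp only [Function.onFun, Function.update_of_ne (hne k hk),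
          Function.update_of_ne (hne l hl)]
        exact hdisj hk hl hkl
      · rw [Function.update_self, Function.update_of_ne (hne k hk)]
        exact (disjoint_sdiff_self_left.mono_left (hB k hk).1).symm

end Atomless

/-! ### Induced beliefs and self-supporting messages -/

section Posterior

variable {T : Type*} [MeasurableSpace T]

/-- The receiver's belief on learning only that the type belongs to `K`; for a null set `K`, the
prior. -/
noncomputable def posterior (F : ProbabilityMeasure T) (K : Set T) : ProbabilityMeasure T :=
  open Classical in
  if h : (F : Measure T) K = 0 then F else
    ⟨cond (F : Measure T) K, cond_isProbabilityMeasure h⟩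

lemma coe_posterior (F : ProbabilityMeasure T) {K : Set T} (h : (F : Measure T) K ≠ 0) :
    (posterior F K : Measure T) = ((F : Measure T) K)⁻¹ • (F : Measure T).restrict K := by
  have : posterior F K = ⟨cond (F : Measure T) K, cond_isProbabilityMeasure h⟩ := dif_neg h
  rw [this]
  rfl

lemma integral_posterior (F : ProbabilityMeasure T) {K : Set T} (h : (F : Measure T) K ≠ 0)
    (f : T → ℝ) : ∫ x, f x ∂(posterior F K : Measure T) =
      ((F : Measure T).real K)⁻¹ * ∫ x in K, f x ∂(F : Measure T) := by
  rw [coe_posterior F h, integral_smul_measure, ENNReal.toReal_inv, smul_eq_mul]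
  rfl

lemma measureReal_mul_integral_posterior (F : ProbabilityMeasure T) (K : Set T) (f : T → ℝ) :
    (F : Measure T).real K * ∫ x, f x ∂(posterior F K : Measure T) =
      ∫ x in K, f x ∂(F : Measure T) := by
  by_cases h : (F : Measure T) K = 0
  · simp [Measure.real, h, Measure.restrict_eq_zero.2 h]
  · rw [integral_posterior F h, mul_inv_cancel_left₀]
    exact (measureReal_ne_zero_iff).2 h

end Posterior

section Messages

variable {T : Type*} [MetricSpace T] [CompactSpace T] [MeasurableSpace T] [BorelSpace T]

/-- Up to small measure a set of types can be replaced by a closed subset all of whose points are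
in the support of the induced belief. -/
lemma exists_isClosed_support_restrict_eq (F : Measure T) [IsFiniteMeasure F] {S : Set T}
    (hS : MeasurableSet S) {e : ℝ≥0∞} (he : e ≠ 0) :
    ∃ K ⊆ S, IsClosed K ∧ (F.restrict K).support = K ∧ F (S \ K) < e := by
  obtain ⟨K', hK'S, hK', hlt⟩ := hS.exists_isClosed_sdiff_lt (measure_ne_top F S) he
  let K := (F.restrict K').support
  have hKK' : K ⊆ K' := Measure.support_subset_of_isClosed hK' (ae_restrict_mem hK'.measurableSet)
  have hcl : IsClosed K := Measure.isClosed_support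
  have h0 : F (K' \ K) = 0 := by
    have h : (F.restrict K') Kᶜ = 0 := Measure.measure_compl_support
    rwa [Measure.restrict_apply hcl.measurableSet.compl, inter_comm, ← sdiff_eq] at h
  have hres : F.restrict K = F.restrict K' :=
    Measure.restrict_congr_set
      ((ae_eq_set (s := K) (t := K')).2 ⟨by simp [sdiff_eq_empty.2 hKK'], h0⟩)
  refine ⟨K, hKK'.trans hK'S, hcl, by rw [hres], ?_⟩
  refine lt_of_le_of_lt ?_ hlt
  have : S \ K ⊆ (S \ K') ∪ (K' \ K) := by
    intro x hx
    by_cases hx' : x ∈ K'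
    · exact Or.inr ⟨hx', hx.2⟩
    · exact Or.inl ⟨hx.1, hx'⟩
  calc F (S \ K) ≤ F ((S \ K') ∪ (K' \ K)) := measure_mono this
    _ ≤ F (S \ K') + F (K' \ K) := measure_union_le _ _
    _ = F (S \ K') := by rw [h0, add_zero]

/-- Almost all of a measurable set of types is covered by a sequence of disjoint closed sets that
support their induced beliefs. -/
lemma exists_seq_isClosed_support_restrict_eq (F : Measure T) [IsFiniteMeasure F] {R : Set T}
    (hR : MeasurableSet R) :
    ∃ L : ℕ → Set T, (∀ i, L i ⊆ R ∧ IsClosed (L i) ∧ (F.restrict (L i)).support = L i) ∧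
      Pairwise (Function.onFun Disjoint L) ∧ F (R \ ⋃ i, L i) = 0 := by
  have key : ∀ (S : {S : Set T // MeasurableSet S}) (n : ℕ),
      ∃ K ⊆ S.1, IsClosed K ∧ (F.restrict K).support = K ∧ F (S.1 \ K) < ((n : ℝ≥0∞) + 1)⁻¹ :=
    fun S n => exists_isClosed_support_restrict_eq F S.2 (by simp)
  choose K hKS hKc hKs hKlt using key
  let Q : ℕ → {S : Set T // MeasurableSet S} := fun n =>
    Nat.rec ⟨R, hR⟩ (fun n S => ⟨S.1 \ K S n, S.2.diff (hKc S n).measurableSet⟩) n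
  have hQ : ∀ n, (Q (n + 1)).1 = (Q n).1 \ K (Q n) n := fun n => rfl
  have hanti : Antitone fun n => (Q n).1 := antitone_nat_of_succ_le fun n => by
    rw [hQ]; exact sdiff_subset
  refine ⟨fun n => K (Q n) n, fun i => ⟨?_, hKc _ _, hKs _ _⟩, ?_, ?_⟩
  · exact (hKS _ _).trans (hanti (Nat.zero_le i))
  · have hlt : ∀ i j, i < j → Disjoint (K (Q i) i) (K (Q j) j) := by
      intro i j hij
      have h1 : K (Q j) j ⊆ (Q i).1 \ K (Q i) i :=
        (hKS _ _).trans ((hanti (Nat.succ_le_of_lt hij)).trans (hQ i).le)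
      exact (disjoint_sdiff_self_left.mono_left h1).symm
    intro i j hij
    rcases lt_or_gt_of_ne hij with h | h
    · exact hlt i j h
    · exact (hlt j i h).symm
  · have hsub : ∀ n, R \ ⋃ i, K (Q i) i ⊆ (Q n).1 := by
      intro n
      induction n with
      | zero => exact sdiff_subset
      | succ n ih =>
        rw [hQ]
        exact fun x hx => ⟨ih hx, fun h => hx.2 (mem_iUnion.2 ⟨n, h⟩)⟩
    have hle : ∀ n : ℕ, F (R \ ⋃ i, K (Q i) i) ≤ ((n : ℝ≥0∞) + 1)⁻¹ := fun n =>
      (measure_mono ((hsub (n + 1)).trans (hQ n).le)).trans (hKlt _ _).le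
    refine le_antisymm (ge_of_tendsto' (x := atTop) ?_ hle) zero_le
    have := (tendsto_add_atTop_iff_nat 1).2 ENNReal.tendsto_inv_nat_nhds_zero
    simpa using this

/-- A finite measurable grid of mesh `δ`, given by the map from types to grid points. -/
lemma exists_simpleFunc_dist_lt [Nonempty T] {δ : ℝ} (hδ : 0 < δ) :
    ∃ c : SimpleFunc T T, ∀ x, dist (c x) x < δ := by
  have hcov : (univ : Set T) ⊆ ⋃ k, Metric.ball (TopologicalSpace.denseSeq T k) δ := by
    intro x _
    obtain ⟨k, hk⟩ := (TopologicalSpace.denseRange_denseSeq T).exists_dist_lt x hδ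
    exact mem_iUnion.2 ⟨k, hk⟩
  obtain ⟨t, ht⟩ := isCompact_univ.elim_finite_subcover _ (fun k => Metric.isOpen_ball) hcov
  refine ⟨SimpleFunc.nearestPt (TopologicalSpace.denseSeq T) (t.sup id), fun x => ?_⟩
  obtain ⟨k, hk, hxk⟩ := mem_iUnion₂.1 (ht (mem_univ x))
  have h := SimpleFunc.edist_nearestPt_le (TopologicalSpace.denseSeq T) x
    (Finset.le_sup (f := id) hk)
  rw [edist_dist, edist_dist, ENNReal.ofReal_le_ofReal_iff dist_nonneg] at h
  exact h.trans_lt (by rw [dist_comm]; exact hxk)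

/-- A finite decomposition of (part of) an atomless measure `F` can be mimicked by disjoint sets of
types: cut each cell of a fine grid into pieces with the masses that the components give it. -/
lemma exists_disjoint_abs_setIntegral_sub_le [Nonempty T] (F : Measure T) [IsFiniteMeasure F]
    [NullSingletonClass F] {ι : Type*} [Fintype ι] (ν : ι → Measure T) [∀ k, IsFiniteMeasure (ν k)]
    (hν : ∑ k, ν k ≤ F) {δ : ℝ} (hδ : 0 < δ) :
    ∃ B : ι → Set T, (∀ k, MeasurableSet (B k)) ∧ Pairwise (Function.onFun Disjoint B) ∧
      ∀ k, ∀ f : C(T, ℝ), ∀ e : ℝ, (∀ x y, dist x y < δ → |f x - f y| ≤ e) →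
        |∫ x in B k, f x ∂F - ∫ x, f x ∂(ν k)| ≤ 2 * e * (ν k).real univ := by
  classical
  obtain ⟨c, hc⟩ := exists_simpleFunc_dist_lt (T := T) hδ
  have hcell : ∀ y : T, ∑ k, ν k (c ⁻¹' {y}) ≤ F (c ⁻¹' {y}) := by
    intro y
    have := hν (c ⁻¹' {y})
    simpa [Measure.finsetSum_apply] using this
  choose B hB hBd using fun y => exists_pairwiseDisjoint_measure_eq F Finset.univ
    (fun k => ν k (c ⁻¹' {y})) (c.measurableSet_fiber y) (hcell y)
  have hBm : ∀ k, MeasurableSet (⋃ y ∈ c.range, B y k) := fun k =>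
    Finset.measurableSet_biUnion _ fun y _ => (hB y k (Finset.mem_univ k)).2.1
  have hmass : ∀ k y, (F.restrict (⋃ y ∈ c.range, B y k)) (c ⁻¹' {y}) = ν k (c ⁻¹' {y}) := by
    intro k y
    rw [Measure.restrict_apply (c.measurableSet_fiber y)]
    by_cases hy : y ∈ c.range
    · have : c ⁻¹' {y} ∩ ⋃ y ∈ c.range, B y k = B y k := by
        refine Subset.antisymm ?_ ?_
        · rintro x ⟨hx, hx'⟩
          obtain ⟨y', _, hxy'⟩ := mem_iUnion₂.1 hx'
          have h1 : c x = y' := (hB y' k (Finset.mem_univ k)).1 hxy'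
          have h2 : c x = y := hx
          rwa [← h1, h2] at hxy'
        · exact fun x hx => ⟨(hB y k (Finset.mem_univ k)).1 hx, mem_iUnion₂.2 ⟨y, hy, hx⟩⟩
      rw [this, (hB y k (Finset.mem_univ k)).2.2]
    · have : c ⁻¹' {y} = ∅ := by
        ext x
        simp only [mem_preimage, mem_singleton_iff, mem_empty_iff_false, iff_false]
        exact fun h => hy (by rw [← h]; exact c.mem_range_self x)
      simp [this]
  refine ⟨fun k => ⋃ y ∈ c.range, B y k, hBm, ?_, ?_⟩
  · intro k l hkl
    refine Set.disjoint_left.2 fun x hx hx' => ?_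
    obtain ⟨y, _, hxy⟩ := mem_iUnion₂.1 hx
    obtain ⟨y', _, hxy'⟩ := mem_iUnion₂.1 hx'
    have h1 : c x = y := (hB y k (Finset.mem_univ k)).1 hxy
    have h2 : c x = y' := (hB y' l (Finset.mem_univ l)).1 hxy'
    rw [← h2, h1] at hxy'
    exact Set.disjoint_left.1 (hBd y (Finset.mem_coe.2 (Finset.mem_univ k))
      (Finset.mem_coe.2 (Finset.mem_univ l)) hkl) hxy hxy'
  · intro k f e hfe
    set μ := F.restrict (⋃ y ∈ c.range, B y k) with hμ
    have hint : ∀ (m : Measure T) [IsFiniteMeasure m] (g : T → ℝ),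
        ∫ x, g (c x) ∂m = ∑ y ∈ c.range, m.real (c ⁻¹' {y}) * g y := by
      intro m _ g
      have h1 : (fun x => g (c x)) = fun x => ∑ y ∈ c.range, (c ⁻¹' {y}).indicator
          (fun _ => g y) x := by
        ext x
        rw [Finset.sum_eq_single (c x)]
        · simp
        · intro y _ hy
          exact indicator_of_notMem (s := c ⁻¹' {y}) (fun h => hy (mem_singleton_iff.1 h).symm)
            fun _ => g y
        · exact fun h => absurd (c.mem_range_self x) h
      rw [h1, integral_finsetSum _ fun y _ =>
        (integrable_const _).indicator (c.measurableSet_fiber y)]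
      refine Finset.sum_congr rfl fun y _ => ?_
      rw [integral_indicator_const _ (c.measurableSet_fiber y), smul_eq_mul]
    have hsame : ∫ x, f (c x) ∂μ = ∫ x, f (c x) ∂(ν k) := by
      rw [hint _ f, hint _ f]
      refine Finset.sum_congr rfl fun y _ => ?_
      rw [Measure.real, hmass, Measure.real]
    have huniv : μ.real univ = (ν k).real univ := by
      have h1 := hint μ fun _ => 1
      have h2 := hint (ν k) fun _ => 1
      simp only [integral_const, smul_eq_mul, mul_one] at h1 h2
      rw [h1, h2]
      refine Finset.sum_congr rfl fun y _ => ?_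
      rw [Measure.real, hmass, Measure.real]
    have hclose : ∀ (m : Measure T) [IsFiniteMeasure m],
        |∫ x, f x ∂m - ∫ x, f (c x) ∂m| ≤ e * m.real univ := by
      intro m _
      have hi : Integrable (fun x => f (c x)) m := (c.map f).integrable_of_isFiniteMeasure
      rw [← integral_sub (integrable_continuousMap f m) hi, ← Real.norm_eq_abs]
      exact norm_integral_le_of_norm_le_const
        (.of_forall fun x => by
          rw [Real.norm_eq_abs]
          exact hfe _ _ (by rw [dist_comm]; exact hc x))
    have h1 := hclose μ
    have h2 := hclose (ν k)
    rw [huniv, hsame] at h1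
    calc |∫ x, f x ∂μ - ∫ x, f x ∂(ν k)|
        ≤ |∫ x, f x ∂μ - ∫ x, f (c x) ∂(ν k)| + |∫ x, f x ∂(ν k) - ∫ x, f (c x) ∂(ν k)| := by
          rw [abs_sub_comm (∫ x, f x ∂(ν k))]; exact abs_sub_le _ _ _
      _ ≤ 2 * e * (ν k).real univ := by linarith

end Messages

/-! ### Disjoint messages that induce prescribed beliefs -/

section Messages

variable {T : Type*} [MetricSpace T] [CompactSpace T] [MeasurableSpace T] [BorelSpace T]

/-- Given beliefs `H k` with weights `c k` whose mixture is dominated by an atomless prior, there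
are disjoint closed messages with approximately these probabilities that induce approximately
these beliefs when the types in a message all send it. -/
lemma exists_disjoint_messages (F : ProbabilityMeasure T) [NullSingletonClass (F : Measure T)]
    {ι : Type*} [Fintype ι] {c : ι → ℝ≥0} (hc : ∀ k, 0 < c k) {H : ι → ProbabilityMeasure T}
    (hle : ∑ k, c k • (H k : Measure T) ≤ (F : Measure T))
    {N : ι → Set (ProbabilityMeasure T)} (hN : ∀ k, N k ∈ 𝓝 (H k)) {e : ℝ} (he : 0 < e) :
    ∃ K : ι → Set T, (∀ k, IsClosed (K k) ∧ ((F : Measure T).restrict (K k)).support = K k ∧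
      |(F : Measure T).real (K k) - c k| < e ∧ posterior F (K k) ∈ N k) ∧
      Pairwise (Function.onFun Disjoint K) := by
  have : Nonempty T := F.nonempty
  have key : ∀ n : ℕ, ∃ K : ι → Set T,
      (∀ k, IsClosed (K k) ∧ ((F : Measure T).restrict (K k)).support = K k ∧
        ∀ f : C(T, ℝ), ∀ e : ℝ, (∀ x y, dist x y < 1 / ((n : ℝ) + 1) → |f x - f y| ≤ e) →
        |∫ x in K k, f x ∂(F : Measure T) - c k * ∫ x, f x ∂(H k : Measure T)| ≤
          2 * e * c k + ‖f‖ * (1 / ((n : ℝ) + 1))) ∧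
      Pairwise (Function.onFun Disjoint K) := by
    intro n
    have hn : (0 : ℝ) < 1 / ((n : ℝ) + 1) := Nat.one_div_pos_of_nat
    obtain ⟨B, hBm, hBd, hB⟩ := exists_disjoint_abs_setIntegral_sub_le (F : Measure T)
      (fun k => c k • (H k : Measure T)) hle hn
    choose K hKB hKc hKs hKlt using fun k => exists_isClosed_support_restrict_eq (F : Measure T)
      (hBm k) (e := ENNReal.ofReal (1 / ((n : ℝ) + 1))) (by simpa using hn)
    refine ⟨K, fun k => ⟨hKc k, hKs k, fun f e hfe => ?_⟩,
      fun k l hkl => (hBd hkl).mono (hKB k) (hKB l)⟩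
    have h1 := hB k f e hfe
    have h2 : ∫ x, f x ∂(c k • (H k : Measure T)) = c k * ∫ x, f x ∂(H k : Measure T) := by
      rw [integral_smul_nnreal_measure]; rfl
    have h3 : (c k • (H k : Measure T)).real univ = c k := by
      simp [Measure.real]
    rw [h2, h3] at h1
    have h4 : ∫ x in B k \ K k, f x ∂(F : Measure T) =
        ∫ x in B k, f x ∂(F : Measure T) - ∫ x in K k, f x ∂(F : Measure T) :=
      setIntegral_sdiff (hKc k).measurableSet (integrable_continuousMap f _).integrableOn (hKB k)
    have h5 : |∫ x in B k \ K k, f x ∂(F : Measure T)| ≤ ‖f‖ * (1 / ((n : ℝ) + 1)) := by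
      have h6 : |∫ x in B k \ K k, f x ∂(F : Measure T)| ≤
          ‖f‖ * (F : Measure T).real (B k \ K k) := by
        rw [← Real.norm_eq_abs]
        exact norm_setIntegral_le_of_norm_le_const (measure_lt_top _ _)
          (fun x _ => f.norm_coe_le_norm x)
      refine h6.trans (mul_le_mul_of_nonneg_left ?_ (norm_nonneg _))
      exact ENNReal.toReal_le_of_le_ofReal hn.le (hKlt k).le
    rw [h4] at h5
    rw [abs_le] at *
    constructor <;> linarith [h1.1, h1.2, h5.1, h5.2]
  choose K hK hKd using key
  have hlim : ∀ k, ∀ f : C(T, ℝ), Tendsto (fun n => ∫ x in K n k, f x ∂(F : Measure T)) atTop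
      (𝓝 (c k * ∫ x, f x ∂(H k : Measure T))) := by
    intro k f
    rw [Metric.tendsto_atTop]
    intro ε hε
    have huc : UniformContinuous f := CompactSpace.uniformContinuous_of_continuous f.continuous
    have hc0 : (0 : ℝ) < c k := hc k
    obtain ⟨δ, hδ, hfδ⟩ := Metric.uniformContinuous_iff.1 huc (ε / (4 * c k)) (by positivity)
    have ht := tendsto_one_div_add_atTop_nhds_zero_nat (𝕜 := ℝ)
    have h1 := ht.eventually (gt_mem_nhds hδ)
    have h2 := (ht.const_mul ‖f‖).eventually
      (gt_mem_nhds (show ‖f‖ * 0 < ε / 2 by simpa using half_pos hε))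
    obtain ⟨m, hm⟩ := eventually_atTop.1 (h1.and h2)
    refine ⟨m, fun n hn => ?_⟩
    have h3 := (hK n k).2.2 f (ε / (4 * c k)) fun x y hxy =>
      (hfδ (hxy.trans (hm n hn).1)).le
    rw [Real.dist_eq]
    have h4 : 2 * (ε / (4 * c k)) * c k = ε / 2 := by field_simp; norm_num
    rw [h4] at h3
    linarith [(hm n hn).2]
  have hmass : ∀ k, Tendsto (fun n => (F : Measure T).real (K n k)) atTop (𝓝 (c k)) := by
    intro k
    have := hlim k 1
    simpa using this
  have hpost : ∀ k, Tendsto (fun n => posterior F (K n k)) atTop (𝓝 (H k)) := by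
    intro k
    have hc0 : (0 : ℝ) < c k := hc k
    rw [ProbabilityMeasure.tendsto_iff_forall_integral_tendsto]
    intro f
    have h1 := ((hmass k).inv₀ hc0.ne').mul (hlim k f.toContinuousMap)
    rw [inv_mul_cancel_left₀ hc0.ne'] at h1
    refine h1.congr' ?_
    filter_upwards [(hmass k).eventually (lt_mem_nhds hc0)] with n hn
    exact (integral_posterior F (fun h => hn.ne' (by simp [Measure.real, h])) _).symm
  have hev : ∀ᶠ n in atTop, ∀ k, |(F : Measure T).real (K n k) - c k| < e ∧
      posterior F (K n k) ∈ N k := by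
    rw [eventually_all]
    intro k
    exact ((hmass k).eventually (Metric.ball_mem_nhds _ he)).and ((hpost k).eventually (hN k))
  obtain ⟨n, hn⟩ := hev.exists
  exact ⟨K n, fun k => ⟨(hK n k).1, (hK n k).2.1, hn k⟩, hKd n⟩

end Messages

/-! ### Messaging by disjoint messages, and Bayes' rule -/

section BestResponse

variable {T A : Type*} [MeasurableSpace T]

lemma bddAbove_range_integral {uR : A → T → ℝ} {G : ProbabilityMeasure T} {a : A}
    (ha : a ∈ bestResponse uR G) :
    BddAbove (range fun b => ∫ θ, uR b θ ∂(G : Measure T)) :=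
  ⟨_, by rintro _ ⟨b, rfl⟩; exact ha b⟩

lemma optimalPayoff_eq {uR : A → T → ℝ} {G : ProbabilityMeasure T} {a : A}
    (ha : a ∈ bestResponse uR G) : optimalPayoff uR G = ∫ θ, uR a θ ∂(G : Measure T) := by
  have : Nonempty A := ⟨a⟩
  exact le_antisymm (ciSup_le ha) (le_ciSup (bddAbove_range_integral ha) a)

/-- The receiver's payoff is bounded above by any bound on the complete-information values of
`U_R`. -/
lemma receiver_le_of_optimalPayoff_le {uR : A → T → ℝ} (hm : ∀ a, Measurable (uR a))
    (hne : ∀ G : ProbabilityMeasure T, (bestResponse uR G).Nonempty) {C : ℝ}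
    (hC : ∀ G, |optimalPayoff uR G| ≤ C) (a : A) (θ : T) : uR a θ ≤ C := by
  obtain ⟨b, hb⟩ := hne (pointBelief θ)
  have h1 := le_ciSup (bddAbove_range_integral hb) a
  have h2 : ∫ x, uR a x ∂(pointBelief θ : Measure T) = uR a θ :=
    integral_dirac' _ _ (hm a).stronglyMeasurable
  simp only [h2] at h1
  exact h1.trans ((le_abs_self _).trans (hC (pointBelief θ)))

end BestResponse

section OnPath

variable {T : Type*} [MetricSpace T] {I : Type*} {X : Type*}

/-- The function of messages that takes the value `x i` at the on-path message `K i`, and agrees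
with `y` at all other messages. -/
noncomputable def onPath (K : I → Message T) (x : I → X) (y : Message T → X) (m : Message T) : X :=
  open Classical in if h : ∃ i, K i = m then x h.choose else y m

/-- Types in one of the messages `K i` send it; the others reveal themselves. (For disjoint messages
the choice of `i` is unambiguous.) -/
noncomputable def cellMessage (K : I → Message T) (θ : T) : Message T :=
  open Classical in if h : ∃ i, θ ∈ K i then K h.choose else {θ}

lemma onPath_apply {K : I → Message T} (hK : Function.Injective K) (x : I → X)
    (y : Message T → X) (i : I) : onPath K x y (K i) = x i := by
  have h : ∃ j, K j = K i := ⟨i, rfl⟩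
  rw [onPath, dif_pos h, hK h.choose_spec]

lemma onPath_of_notMem {K : I → Message T} (x : I → X) (y : Message T → X) {m : Message T}
    (hm : m ∉ range K) : onPath K x y m = y m := dif_neg hm

lemma measurable_onPath_const [MeasurableSpace X] [Countable I] (K : I → Message T) (x : I → X)
    (y : X) : Measurable (onPath K x fun _ => y) := by
  refine (measurable_const (a := y)).measurable_of_countable_ne
    ((countable_range K).mono fun m hm => ?_)
  by_contra h
  exact hm (onPath_of_notMem x (fun _ => y) h).symm

variable {K : I → Message T}

lemma eq_of_mem_of_mem
    (hKd : Pairwise (Function.onFun Disjoint fun i => (K i : Set T)))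
    {i j : I} {θ : T} (hi : θ ∈ K i) (hj : θ ∈ K j) : i = j := by
  by_contra h
  exact Set.disjoint_left.1 (hKd h) hi hj

lemma message_injective
    (hKd : Pairwise (Function.onFun Disjoint fun i => (K i : Set T))) : Function.Injective K := by
  intro i j h
  obtain ⟨θ, hθ⟩ := (K i).nonempty
  exact eq_of_mem_of_mem hKd hθ (by rw [← h]; exact hθ)

lemma cellMessage_of_mem
    (hKd : Pairwise (Function.onFun Disjoint fun i => (K i : Set T)))
    {i : I} {θ : T} (hi : θ ∈ K i) : cellMessage K θ = K i := by
  have h : ∃ j, θ ∈ K j := ⟨i, hi⟩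
  rw [cellMessage, dif_pos h, eq_of_mem_of_mem hKd h.choose_spec hi]

lemma cellMessage_of_notMem {θ : T} (h : ¬ ∃ i, θ ∈ K i) : cellMessage K θ = {θ} := dif_neg h

lemma mem_cellMessage (θ : T) : θ ∈ cellMessage K θ := by
  by_cases h : ∃ i, θ ∈ K i
  · rw [cellMessage, dif_pos h]; exact h.choose_spec
  · rw [cellMessage_of_notMem h]; exact (TopologicalSpace.NonemptyCompacts.mem_singleton θ θ).2 rfl

lemma measurable_cellMessage [MeasurableSpace T] [BorelSpace T] [Countable I]
    (hKd : Pairwise (Function.onFun Disjoint fun i => (K i : Set T))) :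
    Measurable (cellMessage K) := by
  intro S hS
  have hm : ∀ i, MeasurableSet (K i : Set T) := fun i => (K i).isCompact.measurableSet
  have hsing : Measurable fun θ : T => ({θ} : Message T) :=
    TopologicalSpace.NonemptyCompacts.continuous_singleton.measurable
  have : cellMessage K ⁻¹' S = (⋃ i, {θ | θ ∈ (K i : Set T) ∧ K i ∈ S}) ∪
      ((⋃ i, (K i : Set T))ᶜ ∩ (fun θ : T => ({θ} : Message T)) ⁻¹' S) := by
    ext θ
    by_cases h : ∃ i, θ ∈ K i
    · obtain ⟨i, hi⟩ := h
      have h2 : (∃ j, θ ∈ K j ∧ K j ∈ S) ↔ K i ∈ S :=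
        ⟨fun ⟨j, hj, hjS⟩ => by rwa [eq_of_mem_of_mem hKd hi hj], fun h => ⟨i, hi, h⟩⟩
      have h3 : θ ∈ ⋃ i, (K i : Set T) := mem_iUnion.2 ⟨i, hi⟩
      have h4 : θ ∉ (⋃ i, (K i : Set T))ᶜ := fun h => h h3
      simp only [mem_preimage, cellMessage_of_mem hKd hi, mem_union, mem_iUnion,
        mem_inter_iff, h4, false_and, or_false]
      exact h2.symm
    · have h3 : θ ∉ ⋃ i, (K i : Set T) := fun h' => h (by simpa using h')
      have h4 : ∀ i, θ ∉ K i := fun i hi => h ⟨i, hi⟩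
      simp [cellMessage_of_notMem h, h4]
  rw [this]
  refine (MeasurableSet.iUnion fun i => ?_).union
    ((MeasurableSet.iUnion hm).compl.inter (hsing hS))
  exact (hm i).inter (MeasurableSet.const _)

end OnPath

/-- A payoff that is measurable in the type is jointly measurable along an action rule with
countably many values. -/
lemma measurable_payoff_of_countable_range {A T Y : Type*} [MeasurableSpace T] [MeasurableSpace Y]
    [MeasurableSpace A] [MeasurableSingletonClass A] {u : A → T → ℝ} (hu : ∀ a, Measurable (u a))
    {s : Y → A} (hs : Measurable s) (hc : (range s).Countable) :
    Measurable fun p : T × Y => u (s p.2) p.1 := by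
  intro S hS
  have : (fun p : T × Y => u (s p.2) p.1) ⁻¹' S =
      ⋃ a ∈ range s, (u a ⁻¹' S) ×ˢ (s ⁻¹' {a}) := by
    ext ⟨θ, y⟩
    simp only [mem_preimage, mem_iUnion, mem_prod, mem_singleton_iff, exists_prop]
    exact ⟨fun h => ⟨s y, mem_range_self y, h, rfl⟩, fun ⟨a, _, h, ha⟩ => ha ▸ h⟩
  rw [this]
  exact MeasurableSet.biUnion hc fun a _ => ((hu a) hS).prod (hs (measurableSet_singleton a))

lemma countable_range_onPath_const {T I X : Type*} [MetricSpace T] [Countable I]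
    (K : I → Message T) (x : I → X) (y : X) : (range (onPath K x fun _ => y)).Countable := by
  refine ((countable_range x).insert y).mono ?_
  rintro _ ⟨m, rfl⟩
  by_cases h : ∃ i, K i = m
  · rw [onPath, dif_pos h]; exact Or.inr ⟨_, rfl⟩
  · rw [onPath_of_notMem _ _ h]; exact Or.inl rfl

section Equilibrium

variable {T : Type*} [MetricSpace T] [MeasurableSpace T]
  {F : ProbabilityMeasure T} {I : Type*} {K : I → Message T}

lemma measure_ne_zero_of_support_eq
    (hKs : ∀ i, ((F : Measure T).restrict (K i)).support = K i) (i : I) :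
    (F : Measure T) (K i) ≠ 0 := by
  intro h
  have h2 := hKs i
  rw [Measure.restrict_eq_zero.2 h, Measure.support_zero] at h2
  exact (K i).nonempty.ne_empty h2.symm

lemma support_posterior (hKs : ∀ i, ((F : Measure T).restrict (K i)).support = K i) (i : I) :
    (posterior F (K i) : Measure T).support = K i := by
  rw [coe_posterior F (measure_ne_zero_of_support_eq hKs i)]
  have hne : ((F : Measure T) (K i))⁻¹ ≠ 0 := by simp
  refine Subset.antisymm ?_ ?_
  · conv_rhs => rw [← hKs i]
    exact (Measure.smul_absolutelyContinuous).support_mono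
  · conv_lhs => rw [← hKs i]
    exact (Measure.absolutelyContinuous_smul hne).support_mono

lemma restrict_iUnion_message
    (hK0 : (F : Measure T) (⋃ i, (K i : Set T))ᶜ = 0) :
    (F : Measure T).restrict (⋃ i, (K i : Set T)) = F :=
  Measure.restrict_eq_self_of_ae_mem (by rw [ae_iff]; exact hK0)

variable [CompactSpace T] [BorelSpace T] [Countable I]

lemma map_cellMessage_ae_mem_range
    (hKd : Pairwise (Function.onFun Disjoint fun i => (K i : Set T)))
    (hK0 : (F : Measure T) (⋃ i, (K i : Set T))ᶜ = 0) :
    ∀ᵐ m ∂((F : Measure T).map (cellMessage K)), m ∈ range K := by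
  have hmeas : MeasurableSet {m | m ∈ range K} := (countable_range K).measurableSet
  rw [ae_map_iff (measurable_cellMessage hKd).aemeasurable hmeas]
  have : ∀ᵐ θ ∂(F : Measure T), θ ∈ ⋃ i, (K i : Set T) := by rw [ae_iff]; exact hK0
  filter_upwards [this] with θ hθ
  obtain ⟨i, hi⟩ := mem_iUnion.1 hθ
  exact ⟨i, (cellMessage_of_mem hKd hi).symm⟩

/-- Bayes' rule: after the message `K i`, the type is distributed as the prior conditional on
`K i`. -/
lemma compProd_beliefKernel_posterior
    (hKd : Pairwise (Function.onFun Disjoint fun i => (K i : Set T)))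
    (hK0 : (F : Measure T) (⋃ i, (K i : Set T))ᶜ = 0) :
    (F : Measure T).map (cellMessage K) ⊗ₘ
      beliefKernel (onPath K (fun i => posterior F (K i)) fun _ => F)
        (measurable_onPath_const _ _ _) =
      (F : Measure T).map fun θ => (cellMessage K θ, θ) := by
  have hM := measurable_cellMessage hKd
  have hm : ∀ i, MeasurableSet (K i : Set T) := fun i => (K i).isCompact.measurableSet
  have hpair : Measurable fun θ => (cellMessage K θ, θ) := hM.prodMk measurable_id
  have : IsProbabilityMeasure ((F : Measure T).map (cellMessage K)) :=
    Measure.isProbabilityMeasure_map hM.aemeasurable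
  have : IsProbabilityMeasure ((F : Measure T).map fun θ => (cellMessage K θ, θ)) :=
    Measure.isProbabilityMeasure_map hpair.aemeasurable
  refine Measure.ext_prod fun {s t} hs ht => ?_
  rw [Measure.compProd_apply_prod hs ht, Measure.map_apply hpair (hs.prod ht),
    ← lintegral_indicator hs,
    lintegral_map (Measurable.indicator (Kernel.measurable_coe _ ht) hs) hM]
  have h1 : (fun θ => (cellMessage K θ, θ)) ⁻¹' s ×ˢ t = cellMessage K ⁻¹' s ∩ t := rfl
  rw [h1, ← lintegral_indicator_one ((hM hs).inter ht)]
  conv_lhs => rw [← restrict_iUnion_message hK0]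
  conv_rhs => rw [← restrict_iUnion_message hK0]
  rw [lintegral_iUnion hm hKd, lintegral_iUnion hm hKd]
  refine tsum_congr fun i => ?_
  by_cases hi : K i ∈ s
  · have h2 : ∫⁻ θ in K i, s.indicator (fun m => beliefKernel (onPath K (fun i => posterior F (K i))
        fun _ => F) (measurable_onPath_const _ _ _) m t) (cellMessage K θ) ∂(F : Measure T) =
        ∫⁻ _ in K i, (posterior F (K i) : Measure T) t ∂(F : Measure T) := by
      refine setLIntegral_congr_fun (hm i) fun θ hθ => ?_
      rw [cellMessage_of_mem hKd hθ, indicator_of_mem hi, beliefKernel_apply,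
        onPath_apply (message_injective hKd)]
    have h3 : ∫⁻ θ in K i, (cellMessage K ⁻¹' s ∩ t).indicator 1 θ ∂(F : Measure T) =
        ∫⁻ θ in K i, t.indicator 1 θ ∂(F : Measure T) := by
      refine setLIntegral_congr_fun (hm i) fun θ hθ => ?_
      by_cases ht' : θ ∈ t
      · simp [ht', cellMessage_of_mem hKd hθ, hi]
      · simp [ht']
    rw [h2, h3, lintegral_indicator_one ht, setLIntegral_const]
    by_cases h0 : (F : Measure T) (K i) = 0
    · rw [h0, mul_zero, Measure.restrict_eq_zero.2 h0]; rfl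
    · rw [coe_posterior F h0, Measure.smul_apply, smul_eq_mul, mul_right_comm,
        ENNReal.inv_mul_cancel h0 (measure_ne_top _ _), one_mul]
  · have h2 : ∫⁻ θ in K i, s.indicator (fun m => beliefKernel (onPath K (fun i => posterior F (K i))
        fun _ => F) (measurable_onPath_const _ _ _) m t) (cellMessage K θ) ∂(F : Measure T) =
        ∫⁻ _ in K i, 0 ∂(F : Measure T) := by
      refine setLIntegral_congr_fun (hm i) fun θ hθ => ?_
      rw [cellMessage_of_mem hKd hθ, indicator_of_notMem hi]
    have h3 : ∫⁻ θ in K i, (cellMessage K ⁻¹' s ∩ t).indicator 1 θ ∂(F : Measure T) =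
        ∫⁻ _ in K i, 0 ∂(F : Measure T) := by
      refine setLIntegral_congr_fun (hm i) fun θ hθ => ?_
      simp [cellMessage_of_mem hKd hθ, hi]
    rw [h2, h3]

end Equilibrium

/-! ### Equilibria from disjoint messages -/

section Equilibrium

variable {T A : Type*} [MeasurableSpace T] {F : ProbabilityMeasure T} {uS uR : A → T → ℝ}

/-- The receiver's payoff from any action is at most `C`, and its conditional mean given `S` under a
best response is at least `-C`. This bounds its absolute mean, although no integrable envelope of
the receiver's payoffs is assumed. -/
lemma integral_abs_receiver_le {C : ℝ} [TopologicalSpace A] (hu : RegularPayoffs F uS uR)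
    (hne : ∀ G : ProbabilityMeasure T, (bestResponse uR G).Nonempty)
    (hC : ∀ G, |optimalPayoff uR G| ≤ C)
    {b : A} {S : Set T} (hb : b ∈ bestResponse uR (posterior F S)) :
    ∫ θ in S, ‖uR b θ‖ ∂(F : Measure T) ≤ 3 * C * (F : Measure T).real S := by
  have hC0 : 0 ≤ C := (abs_nonneg _).trans (hC F)
  have hint : IntegrableOn (uR b) S (F : Measure T) := (hu.integrable_receiver b F).integrableOn
  have h1 : ∫ θ in S, ‖uR b θ‖ ∂(F : Measure T) ≤ ∫ θ in S, (2 * C - uR b θ) ∂(F : Measure T) := by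
    refine integral_mono hint.norm ((integrable_const _).sub hint) fun θ => ?_
    have h2 := receiver_le_of_optimalPayoff_le hu.measurable_receiver hne hC b θ
    simp only [Real.norm_eq_abs]
    rcases abs_cases (uR b θ) with ⟨h, _⟩ | ⟨h, _⟩ <;> rw [h] <;> linarith
  refine h1.trans ?_
  rw [integral_sub (integrable_const _) hint, ← measureReal_mul_integral_posterior F S (uR b),
    ← optimalPayoff_eq hb, setIntegral_const, smul_eq_mul]
  have h3 := (abs_le.1 (hC (posterior F S))).1
  nlinarith [measureReal_nonneg (μ := (F : Measure T)) (s := S)]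

end Equilibrium

section Equilibrium

variable {T : Type*} [MetricSpace T] [CompactSpace T] [MeasurableSpace T] [BorelSpace T]
  {A : Type*} [MetricSpace A] [MeasurableSpace A] [BorelSpace A]
  {F : ProbabilityMeasure T} {uS uR : A → T → ℝ} {aStar : T → A}
  {I : Type*} [Countable I] {K : I → Message T} {a : I → A}

/-- Every family of disjoint closed messages that support their induced beliefs and cover almost
all types is the set of on-path messages of an equilibrium, for any best responses to these
beliefs. Deviations to other messages are deterred by attributing them to a worst-case type; a type
then gets at most its full-information payoff, which by the absence of rents it gets on path. -/
theorem exists_supportable_of_messages {C : ℝ} (hu : RegularPayoffs F uS uR)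
    (haStar : IsCompleteInfoAction uS uR aStar) (h_noRents : NoRents uS uR aStar)
    (h_worstCase : HasWorstCaseTypes uS aStar)
    (hne : ∀ G : ProbabilityMeasure T, (bestResponse uR G).Nonempty)
    (hC : ∀ G, |optimalPayoff uR G| ≤ C)
    (hKs : ∀ i, ((F : Measure T).restrict (K i)).support = K i)
    (hKd : Pairwise (Function.onFun Disjoint fun i => (K i : Set T)))
    (hK0 : (F : Measure T) (⋃ i, (K i : Set T))ᶜ = 0)
    (ha : ∀ i, a i ∈ bestResponse uR (posterior F (K i))) :
    ∃ wS wR : ℝ, Supportable F uS uR wS wR ∧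
      HasSum (fun i => ∫ θ in K i, uS (a i) θ ∂(F : Measure T)) wS ∧
      HasSum (fun i => ∫ θ in K i, uR (a i) θ ∂(F : Measure T)) wR := by
  have hne' : Nonempty A := ⟨(hne F).some⟩
  let a₀ : A := hne'.some
  choose θhat hθmem hθworst using h_worstCase
  have hinj := message_injective hKd
  have hMm := measurable_cellMessage hKd
  have hm : ∀ i, MeasurableSet (K i : Set T) := fun i => (K i).isCompact.measurableSet
  let τ : Message T → A := onPath K a fun m => aStar (θhat m)
  let μ : Message T → ProbabilityMeasure T :=
    onPath K (fun i => posterior F (K i)) fun m => pointBelief (θhat m)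
  let ρ : Kernel T (Message T) := Kernel.deterministic (cellMessage K) hMm
  -- A measurable version of the receiver's strategy, equal to it on path.
  let τ' : Message T → A := onPath K a fun _ => a₀
  have hτ'm : Measurable τ' := measurable_onPath_const K a a₀
  have hτ'c : (range τ').Countable := countable_range_onPath_const K a a₀
  have hpairm : Measurable fun θ => (θ, cellMessage K θ) := measurable_id.prodMk hMm
  have hjoint : jointLaw F ρ = (F : Measure T).map fun θ => (θ, cellMessage K θ) :=
    Measure.compProd_deterministic hMm
  have hsnd : (jointLaw F ρ).snd = (F : Measure T).map (cellMessage K) := by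
    rw [hjoint, Measure.snd, Measure.map_map measurable_snd hpairm]
    rfl
  have hrange := map_cellMessage_ae_mem_range hKd hK0
  have hττ' : ∀ m ∈ range K, τ m = τ' m := by
    rintro _ ⟨i, rfl⟩
    exact (onPath_apply hinj a _ i).trans (onPath_apply hinj a _ i).symm
  have hτM : ∀ i, ∀ θ ∈ K i, τ (cellMessage K θ) = a i := fun i θ hθ => by
    rw [cellMessage_of_mem hKd hθ]
    exact onPath_apply hinj a _ i
  have haemem : ∀ᵐ θ ∂(F : Measure T), θ ∈ ⋃ i, (K i : Set T) := by rw [ae_iff]; exact hK0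
  -- Transfer of payoffs from the joint law to the prior.
  have hpay : ∀ u : A → T → ℝ, (∀ b, Measurable (u b)) →
      (∀ i, IntegrableOn (u (a i)) (K i) (F : Measure T)) →
      (Summable fun i => ∫ θ in K i, ‖u (a i) θ‖ ∂(F : Measure T)) →
      Integrable (fun p : T × Message T => u (τ p.2) p.1) (jointLaw F ρ) ∧
      HasSum (fun i => ∫ θ in K i, u (a i) θ ∂(F : Measure T))
        (∫ p, u (τ p.2) p.1 ∂(jointLaw F ρ)) := by
    intro u hum hui hus
    have hmeas : Measurable fun p : T × Message T => u (τ' p.2) p.1 :=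
      measurable_payoff_of_countable_range hum hτ'm hτ'c
    have hae : (fun p : T × Message T => u (τ' p.2) p.1) =ᵐ[jointLaw F ρ]
        fun p => u (τ p.2) p.1 := by
      have h1 : ∀ᵐ p ∂(jointLaw F ρ), p.2 ∈ range K := by
        have h2 := hrange
        rw [← hsnd] at h2
        exact ae_of_ae_map measurable_snd.aemeasurable h2
      filter_upwards [h1] with p hp
      rw [hττ' _ hp]
    have hasm : AEStronglyMeasurable (fun p : T × Message T => u (τ p.2) p.1) (jointLaw F ρ) :=
      (hmeas.aestronglyMeasurable).congr hae
    have hon : IntegrableOn (fun θ => u (τ (cellMessage K θ)) θ) (⋃ i, (K i : Set T))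
        (F : Measure T) := by
      refine integrableOn_iUnion_of_summable_integral_norm (fun i => ?_) ?_
      · exact (hui i).congr_fun (fun θ hθ => by rw [hτM i θ hθ]) (hm i)
      · refine hus.congr fun i => ?_
        exact setIntegral_congr_fun (hm i) fun θ hθ => by simp only [hτM i θ hθ]
    have hsum := hasSum_integral_iUnion hm hKd hon
    rw [restrict_iUnion_message hK0] at hsum
    have hint : Integrable (fun θ => u (τ (cellMessage K θ)) θ) (F : Measure T) := by
      rw [IntegrableOn, restrict_iUnion_message hK0] at hon
      exact hon
    rw [hjoint] at hasm ⊢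
    refine ⟨(integrable_map_measure hasm hpairm.aemeasurable).2 hint, ?_⟩
    rw [integral_map hpairm.aemeasurable hasm]
    refine hsum.congr_fun fun i => ?_
    exact setIntegral_congr_fun (hm i) fun θ hθ => by simp only [hτM i θ hθ]
  have hsummass : Summable fun i => (F : Measure T).real (K i) := by
    apply ENNReal.summable_toReal
    rw [← measure_iUnion hKd hm]
    exact measure_ne_top _ _
  obtain ⟨g, hg, hug⟩ := hu.envelope_sender
  have hS := hpay uS hu.measurable_sender (fun i => (hu.integrable_sender _ F).integrableOn) (by
    have hgs : Summable fun i => ∫ θ in K i, g θ ∂(F : Measure T) :=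
      (hasSum_integral_iUnion hm hKd hg.integrableOn).summable
    refine hgs.of_nonneg_of_le (fun i => integral_nonneg fun _ => norm_nonneg _) fun i => ?_
    exact integral_mono (hu.integrable_sender _ F).integrableOn.norm hg.integrableOn
      fun θ => hug _ θ)
  have hR := hpay uR hu.measurable_receiver (fun i => (hu.integrable_receiver _ F).integrableOn) (by
    refine (hsummass.mul_left (3 * C)).of_nonneg_of_le
      (fun i => integral_nonneg fun _ => norm_nonneg _) fun i => ?_
    exact integral_abs_receiver_le hu hne hC (ha i))
  refine ⟨_, _, ⟨ρ, τ, μ, ?_, hS.1, hR.1, rfl, rfl⟩, hS.2, hR.2⟩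
  have hρ : ∀ θ, (ρ θ).support ⊆ {cellMessage K θ} := by
    intro θ
    refine Measure.support_subset_of_isClosed isClosed_singleton ?_
    rw [Kernel.deterministic_apply, mem_ae_iff,
      Measure.dirac_apply' _ (measurableSet_singleton _).compl]
    simp
  have hoff : ∀ (θ : T) (m : Message T), θ ∈ m → m ∉ range K → uS (τ m) θ ≤ uS (aStar θ) θ := by
    intro θ m hθ hmK
    have : τ m = aStar (θhat m) := onPath_of_notMem _ _ hmK
    rw [this]
    exact hθworst m θ hθ
  refine ⟨Kernel.isMarkovKernel_deterministic hMm, ?_, ?_, ?_, ?_, ?_, ?_⟩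
  · rw [hsnd]
    refine ⟨τ', hτ'm, ?_⟩
    filter_upwards [hrange] with m hm'
    exact hττ' m hm'
  · intro θ m hmρ
    rw [mem_singleton_iff.1 (hρ θ hmρ)]
    exact mem_cellMessage θ
  · intro θ m hmρ
    rw [mem_singleton_iff.1 (hρ θ hmρ)]
    refine ⟨mem_cellMessage θ, fun m' hθm' => ?_⟩
    by_cases h : ∃ i, θ ∈ K i
    · obtain ⟨i, hi⟩ := h
      rw [hτM i θ hi]
      by_cases hm' : m' ∈ range K
      · obtain ⟨j, rfl⟩ := hm'
        rw [eq_of_mem_of_mem hKd hi hθm']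
        exact le_of_eq (by rw [show τ (K j) = a j from onPath_apply hinj a _ j])
      · refine (hoff θ m' hθm' hm').trans (h_noRents θ _ ?_ (a i) (ha i))
        rw [support_posterior hKs i]
        exact hi
    · have hnr : ∀ m : Message T, θ ∈ m → m ∉ range K := by
        rintro _ hθ ⟨i, rfl⟩
        exact h ⟨i, hθ⟩
      have h1 : θhat ({θ} : Message T) = θ :=
        (TopologicalSpace.NonemptyCompacts.mem_singleton _ _).1 (hθmem {θ})
      have h2 : τ (cellMessage K θ) = aStar θ := by
        have h3 : τ (cellMessage K θ) = aStar (θhat (cellMessage K θ)) :=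
          onPath_of_notMem _ _ (hnr _ (mem_cellMessage θ))
        rw [h3, cellMessage_of_notMem h, h1]
      rw [h2]
      exact hoff θ m' hθm' (hnr m' hθm')
  · intro m
    by_cases hm' : m ∈ range K
    · obtain ⟨i, rfl⟩ := hm'
      rw [show τ (K i) = a i from onPath_apply hinj a _ i,
        show μ (K i) = posterior F (K i) from onPath_apply hinj _ _ i]
      exact ha i
    · rw [show τ m = aStar (θhat m) from onPath_of_notMem _ _ hm',
        show μ m = pointBelief (θhat m) from onPath_of_notMem _ _ hm']
      exact (haStar (θhat m)).1
  · intro m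
    by_cases hm' : m ∈ range K
    · obtain ⟨i, rfl⟩ := hm'
      rw [show μ (K i) = posterior F (K i) from onPath_apply hinj _ _ i]
      exact (support_posterior hKs i).le
    · rw [show μ m = pointBelief (θhat m) from onPath_of_notMem _ _ hm']
      have h1 : (pointBelief (θhat m) : Measure T).support ⊆ {θhat m} := by
        refine Measure.support_subset_of_isClosed isClosed_singleton ?_
        change {θhat m} ∈ ae (Measure.dirac (θhat m))
        rw [mem_ae_iff, Measure.dirac_apply' _ (measurableSet_singleton _).compl]
        simp
      exact h1.trans (singleton_subset_iff.2 (hθmem m))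
  · refine ⟨beliefKernel (onPath K (fun i => posterior F (K i)) fun _ => F)
      (measurable_onPath_const _ _ _), inferInstance, ?_, ?_⟩
    · rw [hsnd, compProd_beliefKernel_posterior hKd hK0, hjoint,
        Measure.map_map measurable_swap hpairm]
      rfl
    · rw [hsnd]
      filter_upwards [hrange] with m hm'
      obtain ⟨i, rfl⟩ := hm'
      rw [beliefKernel_apply, onPath_apply hinj,
        show μ (K i) = posterior F (K i) from onPath_apply hinj _ _ i]

end Equilibrium

/-! ### Implementation of finite mixtures of beliefs -/

section FiniteApproximation

variable {T : Type*} [MeasurableSpace T]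

/-- Summing errors over finitely many main cells `K k` and the countably many residual cells
`L i`. -/
lemma abs_sub_sum_le_of_cells {F : ProbabilityMeasure T} {ι : Type*} [Fintype ι] {K : ι → Set T}
    {L : ℕ → Set T} (hm : ∀ j, MeasurableSet (Sum.elim K L j))
    (hd : Pairwise (Function.onFun Disjoint (Sum.elim K L)))
    (h0 : (F : Measure T) (⋃ j, Sum.elim K L j)ᶜ = 0)
    {c : ι → ℝ≥0} {ζ D κ w : ℝ} (hD : 0 ≤ D) {v : ι → ℝ} {h : T → ℝ}
    (hh : Integrable h (F : Measure T))
    (hKc : ∀ k, |(F : Measure T).real (K k) - c k| ≤ ζ) {f : ι ⊕ ℕ → ℝ} (hf : HasSum f w)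
    (hfK : ∀ k, |f (Sum.inl k) - c k * v k| ≤
      ∫ θ in K k, h θ ∂(F : Measure T) + κ * (F : Measure T).real (K k) + ζ * D)
    (hfL : ∀ i, |f (Sum.inr i)| ≤
      ∫ θ in L i, h θ ∂(F : Measure T) + D * (F : Measure T).real (L i)) (hκ : 0 ≤ κ) :
    |w - ∑ k, c k * v k| ≤ ∫ θ, h θ ∂(F : Measure T) + κ +
      D * (1 - ∑ k, (c k : ℝ)) + 2 * Fintype.card ι * ζ * D := by
  have huniv : (F : Measure T).restrict (⋃ j, Sum.elim K L j) = F :=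
    Measure.restrict_eq_self_of_ae_mem (by rw [ae_iff]; exact h0)
  have hsum : ∀ g : T → ℝ, Integrable g (F : Measure T) →
      HasSum (fun j => ∫ θ in Sum.elim K L j, g θ ∂(F : Measure T))
        (∫ θ, g θ ∂(F : Measure T)) := by
    intro g hg
    have := hasSum_integral_iUnion hm hd hg.integrableOn
    rwa [huniv] at this
  have hmass : HasSum (fun j => (F : Measure T).real (Sum.elim K L j)) 1 := by
    have := hsum (fun _ => 1) (integrable_const _)
    simpa using this
  have hinl : ∀ g : ι → ℝ, HasSum (Sum.elim g fun _ : ℕ => (0 : ℝ)) (∑ k, g k) := by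
    intro g
    refine (Sum.inl_injective.hasSum_iff ?_).1 (hasSum_fintype g)
    rintro (k | i) hx
    · exact absurd (mem_range_self k) hx
    · rfl
  have hmassL : HasSum (Sum.elim (fun _ : ι => (0 : ℝ)) fun i => (F : Measure T).real (L i))
      (1 - ∑ k, (F : Measure T).real (K k)) := by
    refine (hmass.sub (hinl fun k => (F : Measure T).real (K k))).congr_fun ?_
    rintro (k | i) <;> simp
  have hb := ((hsum h hh).add (hmass.mul_left κ)).add
    ((hinl fun _ => ζ * D).add (hmassL.mul_left D))
  have ht := hf.sub (hinl fun k => c k * v k)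
  have hfin := ht.norm_le_of_bounded hb (by
    rintro (k | i)
    · simpa using hfK k
    · have h1 := hfL i
      have h2 : 0 ≤ κ * (F : Measure T).real (L i) := mul_nonneg hκ measureReal_nonneg
      simp only [Sum.elim_inr, sub_zero, Real.norm_eq_abs, zero_add]
      linarith)
  rw [Real.norm_eq_abs] at hfin
  refine hfin.trans ?_
  have h3 : ∑ k, (c k : ℝ) - Fintype.card ι * ζ ≤ ∑ k, (F : Measure T).real (K k) := by
    have h4 : ∑ k, ((c k : ℝ) - ζ) ≤ ∑ k, (F : Measure T).real (K k) :=
      Finset.sum_le_sum fun k _ => by linarith [(abs_le.1 (hKc k)).1]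
    simpa [Finset.sum_sub_distrib] using h4
  have h5 : D * (1 - ∑ k, (F : Measure T).real (K k)) ≤
      D * (1 - (∑ k, (c k : ℝ) - Fintype.card ι * ζ)) :=
    mul_le_mul_of_nonneg_left (by linarith) hD
  simp only [Finset.sum_const, Finset.card_univ, nsmul_eq_mul, mul_one]
  linarith

variable [MetricSpace T] [CompactSpace T] [BorelSpace T]
  {A : Type*} [MetricSpace A] [MeasurableSpace A] [BorelSpace A]
  {F : ProbabilityMeasure T} {uS uR : A → T → ℝ} {aStar : T → A}

/-- A finite mixture of beliefs dominated by the prior, with nearly unique best responses, is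
almost implemented by an equilibrium. -/
theorem exists_supportable_of_finite [NullSingletonClass (F : Measure T)]
    (hu : RegularPayoffs F uS uR)
    (haStar : IsCompleteInfoAction uS uR aStar) (h_noRents : NoRents uS uR aStar)
    (h_worstCase : HasWorstCaseTypes uS aStar) (h_cont : ContinuityConditions uS uR)
    {φ : C(T, C(A, ℝ))} {h : T → ℝ} (hh : Integrable h (F : Measure T))
    (hφ : ∀ b θ, |uS b θ - φ θ b| ≤ h θ) {D : ℝ} (hφD : ∀ θ b, |φ θ b| ≤ D)
    (hRD : ∀ G, |optimalPayoff uR G| ≤ D) {δ e₁ : ℝ}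
    (hmod : ∀ θ a b, dist a b < δ → |φ θ a - φ θ b| ≤ e₁) (he₁ : 0 ≤ e₁)
    {ι : Type*} [Fintype ι] {c : ι → ℝ≥0} (hc : ∀ k, 0 < c k) {H : ι → ProbabilityMeasure T}
    (hle : ∑ k, c k • (H k : Measure T) ≤ (F : Measure T)) {α : ι → A}
    (hα : ∀ k, bestResponse uR (H k) ⊆ Metric.ball (α k) δ) {e : ℝ} (he : 0 < e) :
    ∃ wS wR : ℝ, Supportable F uS uR wS wR ∧
      |wS - ∑ k, c k * ∫ θ, φ θ (α k) ∂(H k : Measure T)| ≤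
        ∫ θ, h θ ∂(F : Measure T) + e₁ + D * (1 - ∑ k, (c k : ℝ)) + e ∧
      |wR - ∑ k, c k * optimalPayoff uR (H k)| ≤ D * (1 - ∑ k, (c k : ℝ)) + e := by
  have hD0 : 0 ≤ D := (abs_nonneg _).trans (hRD F)
  have hφc : ∀ b, Continuous fun θ => φ θ b := fun b =>
    (continuous_eval_const b).comp φ.continuous
  have hφi : ∀ b, Integrable (fun θ => φ θ b) (F : Measure T) := fun b =>
    integrable_continuousMap ⟨_, hφc b⟩ _
  set n : ℝ := (Fintype.card ι : ℝ) with hn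
  have hn0 : 0 ≤ n := by positivity
  -- Besides an error proportional to its mass, each main cell contributes at most `2 * ζ * D`.
  set ζ : ℝ := e / (1 + 2 * n * D) with hζ
  have hζ0 : 0 < ζ := by positivity
  have hζe : ζ + 2 * n * ζ * D = e := by rw [hζ]; field_simp
  let N : ι → Set (ProbabilityMeasure T) := fun k =>
    {G | bestResponse uR G ⊆ Metric.ball (α k) δ} ∩
    ({G | |∫ θ, φ θ (α k) ∂(G : Measure T) - ∫ θ, φ θ (α k) ∂(H k : Measure T)| < ζ} ∩
      {G | |optimalPayoff uR G - optimalPayoff uR (H k)| < ζ})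
  have hN : ∀ k, N k ∈ 𝓝 (H k) := by
    intro k
    refine inter_mem ?_ (inter_mem ?_ ?_)
    · exact h_cont.upperHemicontinuous_bestResponse.forall_isOpen (H k) _ Metric.isOpen_ball (hα k)
    · exact (ProbabilityMeasure.continuous_integral_continuousMap
        (⟨_, hφc (α k)⟩ : C(T, ℝ))).continuousAt.preimage_mem_nhds (Metric.ball_mem_nhds _ hζ0)
    · exact h_cont.continuous_optimalPayoff.continuousAt.preimage_mem_nhds
        (Metric.ball_mem_nhds _ hζ0)
  obtain ⟨K, hK, hKd⟩ := exists_disjoint_messages F hc hle hN hζ0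
  have hRm : MeasurableSet (⋃ k, K k)ᶜ :=
    (MeasurableSet.iUnion fun k => (hK k).1.measurableSet).compl
  obtain ⟨L, hL, hLd, hL0⟩ := exists_seq_isClosed_support_restrict_eq (F : Measure T) hRm
  let Q : ι ⊕ ℕ → Set T := Sum.elim K L
  have hQc : ∀ j, IsClosed (Q j) := by
    rintro (k | i)
    · exact (hK k).1
    · exact (hL i).2.1
  have hQs : ∀ j, ((F : Measure T).restrict (Q j)).support = Q j := by
    rintro (k | i)
    · exact (hK k).2.1
    · exact (hL i).2.2
  have hKL : ∀ k i, Disjoint (K k) (L i) := fun k i =>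
    (disjoint_compl_right.mono_right (hL i).1).mono_left (subset_iUnion K k)
  have hQd : Pairwise (Function.onFun Disjoint Q) := by
    rintro (k | i) (l | j) hne
    · exact hKd fun h => hne (by rw [h])
    · exact hKL k j
    · exact (hKL l i).symm
    · exact hLd fun h => hne (by rw [h])
  have hQ0 : (F : Measure T) (⋃ j, Q j)ᶜ = 0 := by
    have : (⋃ j, Q j)ᶜ = (⋃ k, K k)ᶜ \ ⋃ i, L i := by
      rw [iUnion_sum, compl_union, sdiff_eq]
      rfl
    rw [this, hL0]
  choose a ha using fun j => h_cont.nonempty_bestResponse (posterior F (Q j))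
  -- Empty cells are not messages; they carry no mass.
  let J := {j : ι ⊕ ℕ // (Q j).Nonempty}
  let M : J → Message T := fun j => ⟨⟨Q j, (hQc j).isCompact⟩, j.2⟩
  have hM0 : (F : Measure T) (⋃ j, (M j : Set T))ᶜ = 0 := by
    have : (⋃ j, (M j : Set T)) = ⋃ j, Q j := by
      ext θ
      simp only [mem_iUnion]
      exact ⟨fun ⟨j, hj⟩ => ⟨j, hj⟩, fun ⟨j, hj⟩ => ⟨⟨j, ⟨θ, hj⟩⟩, hj⟩⟩
    rw [this, hQ0]
  obtain ⟨wS, wR, hw, hwS, hwR⟩ := exists_supportable_of_messages (K := M) (a := fun j => a j)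
    hu haStar h_noRents h_worstCase h_cont.nonempty_bestResponse hRD (fun j => hQs j)
    (fun j l hjl => hQd fun h => hjl (Subtype.ext h)) hM0 (fun j => ha j)
  have hlift : ∀ (u : A → T → ℝ) (w : ℝ),
      HasSum (fun j : J => ∫ θ in M j, u (a j) θ ∂(F : Measure T)) w →
      HasSum (fun j => ∫ θ in Q j, u (a j) θ ∂(F : Measure T)) w := by
    intro u w hsum
    refine (hasSum_subtype_iff_of_support_subset (s := {j | (Q j).Nonempty}) ?_).1 hsum
    intro j hj
    by_contra hne
    exact hj (by simp [not_nonempty_iff_eq_empty.1 hne])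
  have hQm : ∀ j, MeasurableSet (Q j) := fun j => (hQc j).measurableSet
  have hKc : ∀ k, |(F : Measure T).real (K k) - c k| ≤ ζ := fun k => (hK k).2.2.1.le
  -- Conditional payoffs on a main cell, given their closeness to those at the belief `H k`.
  have hcell : ∀ k (x y : ℝ), |x - y| ≤ ζ → |y| ≤ D →
      |(F : Measure T).real (K k) * x - c k * y| ≤ ζ * (F : Measure T).real (K k) + ζ * D := by
    intro k x y hxy hy
    have h1 : (F : Measure T).real (K k) * x - c k * y =
      (F : Measure T).real (K k) * (x - y) + ((F : Measure T).real (K k) - c k) * y := by ring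
    rw [h1]
    refine (abs_add_le _ _).trans (add_le_add ?_ ?_)
    · rw [abs_mul, abs_of_nonneg measureReal_nonneg, mul_comm]
      exact mul_le_mul_of_nonneg_right hxy measureReal_nonneg
    · rw [abs_mul]
      exact mul_le_mul (hKc k) hy (abs_nonneg _) hζ0.le
  have hφdiff : ∀ j, |∫ θ in Q j, uS (a j) θ ∂(F : Measure T) -
      ∫ θ in Q j, φ θ (a j) ∂(F : Measure T)| ≤ ∫ θ in Q j, h θ ∂(F : Measure T) := by
    intro j
    rw [← integral_sub (hu.integrable_sender _ F).integrableOn (hφi _).integrableOn,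
      ← Real.norm_eq_abs]
    exact norm_integral_le_of_norm_le hh.integrableOn (.of_forall fun θ => hφ _ θ)
  refine ⟨wS, wR, hw, ?_, ?_⟩
  · have := abs_sub_sum_le_of_cells hQm hQd hQ0 (κ := e₁ + ζ) hD0 hh hKc (hlift uS wS hwS)
      (v := fun k => ∫ θ, φ θ (α k) ∂(H k : Measure T)) ?_ ?_ (by positivity)
    · refine this.trans (le_of_eq ?_)
      linarith
    · intro k
      have h1 := hφdiff (Sum.inl k)
      have h2 : |∫ θ in K k, φ θ (a (Sum.inl k)) ∂(F : Measure T) -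
          ∫ θ in K k, φ θ (α k) ∂(F : Measure T)| ≤ e₁ * (F : Measure T).real (K k) := by
        rw [← integral_sub (hφi _).integrableOn (hφi _).integrableOn, ← Real.norm_eq_abs]
        refine norm_setIntegral_le_of_norm_le_const (measure_lt_top _ _) fun θ _ => ?_
        exact hmod θ _ _ ((hK k).2.2.2.1 (ha (Sum.inl k)))
      have h3 := hcell k _ _ (hK k).2.2.2.2.1.le (show
        |∫ θ, φ θ (α k) ∂(H k : Measure T)| ≤ D by
          rw [← Real.norm_eq_abs]
          have := norm_integral_le_of_norm_le_const (μ := (H k : Measure T))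
            (f := fun θ => φ θ (α k)) (.of_forall fun θ => hφD θ (α k))
          simpa using this)
      rw [measureReal_mul_integral_posterior F (K k) fun θ => φ θ (α k)] at h3
      simp only [Q, Sum.elim_inl] at h1 ⊢
      rw [abs_le] at *
      constructor <;> linarith [h1.1, h1.2, h2.1, h2.2, h3.1, h3.2]
    · intro i
      have h1 := hφdiff (Sum.inr i)
      have h2 : |∫ θ in L i, φ θ (a (Sum.inr i)) ∂(F : Measure T)| ≤
          D * (F : Measure T).real (L i) := by
        rw [← Real.norm_eq_abs]
        exact norm_setIntegral_le_of_norm_le_const (measure_lt_top _ _) fun θ _ => hφD θ _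
      simp only [Q, Sum.elim_inr] at h1 ⊢
      rw [abs_le] at *
      constructor <;> linarith [h1.1, h1.2, h2.1, h2.2]
  · have := abs_sub_sum_le_of_cells hQm hQd hQ0 (κ := ζ) hD0 (h := fun _ => 0)
      (integrable_const _) hKc (hlift uR wR hwR)
      (v := fun k => optimalPayoff uR (H k)) ?_ ?_ (by positivity)
    · refine this.trans (le_of_eq ?_)
      rw [integral_zero]
      linarith
    · intro k
      have h3 := hcell k _ _ (hK k).2.2.2.2.2.le (hRD (H k))
      have hak : a (Sum.inl k) ∈ bestResponse uR (posterior F (K k)) := ha (Sum.inl k)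
      rw [optimalPayoff_eq hak] at h3
      simp only [Q, Sum.elim_inl] at h3 ⊢
      rw [measureReal_mul_integral_posterior F (K k)] at h3
      simpa using h3
    · intro i
      have h3 := hRD (posterior F (L i))
      have h4 : (F : Measure T).real (L i) * optimalPayoff uR (posterior F (L i)) =
          ∫ θ in L i, uR (a (Sum.inr i)) θ ∂(F : Measure T) := by
        have hai : a (Sum.inr i) ∈ bestResponse uR (posterior F (L i)) := ha (Sum.inr i)
        rw [optimalPayoff_eq hai]
        exact measureReal_mul_integral_posterior F (L i) _
      simp only [Q, Sum.elim_inr, integral_zero, zero_add]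
      rw [← h4, abs_mul, abs_of_nonneg measureReal_nonneg, mul_comm]
      exact mul_le_mul_of_nonneg_right h3 measureReal_nonneg

end FiniteApproximation

/-! ### Reduction to finite mixtures -/

lemma integral_kernel_comp_measure {Ω T : Type*} [MeasurableSpace Ω] [MeasurableSpace T]
    (P : Measure Ω) [SFinite P] (κ : Kernel Ω T) [IsSFiniteKernel κ] {f : T → ℝ}
    (hf : Integrable f (κ ∘ₘ P)) : ∫ x, f x ∂(κ ∘ₘ P) = ∫ ω, ∫ x, f x ∂(κ ω) ∂P := by
  rw [← Measure.snd_compProd, Measure.snd] at hf ⊢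
  have hf' := (integrable_map_measure hf.aestronglyMeasurable measurable_snd.aemeasurable).1 hf
  rw [integral_map measurable_snd.aemeasurable hf.aestronglyMeasurable]
  exact Measure.integral_compProd hf'

section Mixture

variable {T : Type*} [MeasurableSpace T] {Ω : Type*} [MeasurableSpace Ω]

/-- The mixture of the beliefs `H ω`, `ω ∈ W`, under the conditional law `P[· | W]`;
the zero measure if `W` is null. -/
noncomputable def mixture (P : Measure Ω) {H : Ω → ProbabilityMeasure T} (hH : Measurable H)
    (W : Set Ω) : Measure T :=
  (P W)⁻¹ • (beliefKernel H hH ∘ₘ P.restrict W)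

variable {P : Measure Ω} [IsFiniteMeasure P] {H : Ω → ProbabilityMeasure T} (hH : Measurable H)
  {W : Set Ω}

lemma isProbabilityMeasure_mixture (hW : P W ≠ 0) : IsProbabilityMeasure (mixture P hH W) := by
  constructor
  rw [mixture, Measure.smul_apply, Measure.bind_apply MeasurableSet.univ
    (Kernel.measurable _).aemeasurable]
  simp [ENNReal.inv_mul_cancel hW (measure_ne_top _ _)]

lemma smul_mixture (hW : P W ≠ 0) :
    (P W).toNNReal • mixture P hH W = beliefKernel H hH ∘ₘ P.restrict W := by
  have h : ((P W).toNNReal : ℝ≥0∞) = P W := ENNReal.coe_toNNReal (measure_ne_top _ _)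
  change ((P W).toNNReal : ℝ≥0∞) • mixture P hH W = _
  rw [h, mixture, smul_smul, ENNReal.mul_inv_cancel hW (measure_ne_top _ _), one_smul]

lemma measureReal_mul_integral_mixture (hW : P W ≠ 0) {f : T → ℝ}
    (hf : Integrable f (beliefKernel H hH ∘ₘ P.restrict W)) :
    P.real W * ∫ x, f x ∂(mixture P hH W) = ∫ ω in W, ∫ x, f x ∂(H ω : Measure T) ∂P := by
  rw [mixture, integral_smul_measure, ENNReal.toReal_inv, smul_eq_mul, ← Measure.real,
    mul_inv_cancel_left₀ ((measureReal_ne_zero_iff).2 hW), integral_kernel_comp_measure _ _ hf]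
  rfl

end Mixture

section Discretization

variable {T : Type*} [MetricSpace T] [CompactSpace T] [MeasurableSpace T] [BorelSpace T]
  {A : Type*} [MetricSpace A] {uS uR : A → T → ℝ} {Ω : Type*}

/-- Countably many basic neighbourhoods that are subordinate to given ones cover the beliefs `H ω`,
since the space of beliefs is second countable. -/
lemma exists_seq_testBall_cover [Nonempty Ω] (H : Ω → ProbabilityMeasure T)
    {V : Ω → Set (ProbabilityMeasure T)} (hV : ∀ ω, V ω ∈ 𝓝 (H ω)) :
    ∃ (o : ℕ → Ω) (s : ℕ → Finset C(T, ℝ)) (r : ℕ → ℝ),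
      (∀ n, testBall (s n) (r n) (H (o n)) ⊆ V (o n)) ∧
      ∀ ω, ∃ n, H ω ∈ testBall (s n) (r n) (H (o n)) := by
  choose s r hr hsr using fun ω => exists_testBall_subset (hV ω)
  choose! p hp using fun (G : ProbabilityMeasure T) (hG : G ∈ range H) => hG
  obtain ⟨t, htr, htc, ht⟩ := TopologicalSpace.countable_cover_nhdsWithin (s := range H)
    (f := fun G => testBall (s (p G)) (r (p G)) (H (p G))) (by
      intro G hG
      refine mem_nhdsWithin_of_mem_nhds ?_
      have := testBall_mem_nhds (s (p G)) (hr (p G)) (H (p G))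
      rwa [hp G hG] at this ⊢)
  have htne : t.Nonempty := by
    obtain ⟨ω⟩ := ‹Nonempty Ω›
    obtain ⟨G, hG, _⟩ := mem_iUnion₂.1 (ht (mem_range_self ω))
    exact ⟨G, hG⟩
  obtain ⟨q, rfl⟩ := htc.exists_eq_range htne
  refine ⟨fun n => p (q n), fun n => s (p (q n)), fun n => r (p (q n)), fun n => hsr _, fun ω => ?_⟩
  obtain ⟨G, ⟨n, rfl⟩, hG⟩ := mem_iUnion₂.1 (ht (mem_range_self ω))
  exact ⟨n, hG⟩

variable [MeasurableSpace Ω] {P : Measure Ω} [IsFiniteMeasure P]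
  {H : Ω → ProbabilityMeasure T}

/-- Basic weak neighbourhoods are stable under averaging. -/
lemma mixture_mem_testBall (hH : Measurable H) {W : Set Ω} (hW : P W ≠ 0)
    {s : Finset C(T, ℝ)} {r : ℝ} {G₀ : ProbabilityMeasure T}
    (hWs : ∀ ω ∈ W, H ω ∈ testBall s r G₀) :
    (⟨mixture P hH W, isProbabilityMeasure_mixture hH hW⟩ : ProbabilityMeasure T) ∈
      testBall s r G₀ := by
  intro f hf
  change |∫ x, f x ∂(mixture P hH W) - _| ≤ r
  have hpos : 0 < P.real W :=
    lt_of_le_of_ne measureReal_nonneg ((measureReal_ne_zero_iff).2 hW).symm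
  have hfm : Measurable fun ω => ∫ x, f x ∂(H ω : Measure T) :=
    measurable_integral_belief hH (f := fun _ x => f x)
      ((map_continuous f).measurable.comp measurable_snd)
  have hfi : Integrable (fun ω => ∫ x, f x ∂(H ω : Measure T)) P := by
    refine Integrable.of_bound hfm.aestronglyMeasurable ‖f‖ (.of_forall fun ω => ?_)
    have := norm_integral_le_of_norm_le_const (μ := (H ω : Measure T)) (f := fun x => f x)
      (.of_forall fun x => f.norm_coe_le_norm x)
    simpa using this
  have h1 := measureReal_mul_integral_mixture (P := P) hH hW
    (integrable_continuousMap f (beliefKernel H hH ∘ₘ P.restrict W))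
  have h2 : P.real W * (∫ x, f x ∂(mixture P hH W) - ∫ x, f x ∂(G₀ : Measure T)) =
      ∫ ω in W, (∫ x, f x ∂(H ω : Measure T) - ∫ x, f x ∂(G₀ : Measure T)) ∂P := by
    rw [integral_sub hfi.integrableOn (integrable_const _), mul_sub, h1, setIntegral_const,
      smul_eq_mul]
  have h3 : |∫ ω in W, (∫ x, f x ∂(H ω : Measure T) - ∫ x, f x ∂(G₀ : Measure T)) ∂P| ≤
      r * P.real W := by
    rw [← Real.norm_eq_abs]
    exact norm_setIntegral_le_of_norm_le_const (measure_lt_top _ _) fun ω hω => hWs ω hω f hf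
  rw [← h2, abs_mul, abs_of_pos hpos, mul_comm] at h3
  exact le_of_mul_le_mul_right h3 hpos

/-- A family of beliefs with nearly unique best responses can be replaced, up to small errors in
the payoffs, by a finite mixture of averages of these beliefs. -/
theorem exists_finite_mixture [Nonempty Ω] {ν : Measure T} (h_cont : ContinuityConditions uS uR)
    (hH : Measurable H) {sel : Ω → A} {δ : ℝ}
    (hsel : ∀ ω, bestResponse uR (H ω) ⊆ Metric.ball (sel ω) δ)
    (hbar : beliefKernel H hH ∘ₘ P ≤ ν)
    {φ : C(T, C(A, ℝ))} {D : ℝ} (hφD : ∀ θ b, |φ θ b| ≤ D) (hRD : ∀ G, |optimalPayoff uR G| ≤ D)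
    {e₁ : ℝ} (hmod : ∀ θ a b, dist a b < 2 * δ → |φ θ a - φ θ b| ≤ e₁) (he₁ : 0 ≤ e₁)
    (hφm : Measurable fun ω => ∫ θ, φ θ (sel ω) ∂(H ω : Measure T)) {e : ℝ} (he : 0 < e) :
    ∃ (ι : Type) (_ : Fintype ι) (c : ι → ℝ≥0) (H' : ι → ProbabilityMeasure T) (α : ι → A),
      (∀ k, 0 < c k) ∧ ∑ k, c k • (H' k : Measure T) ≤ ν ∧
      (∀ k, bestResponse uR (H' k) ⊆ Metric.ball (α k) δ) ∧
      P.real univ - e ≤ ∑ k, (c k : ℝ) ∧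
      |∑ k, c k * ∫ θ, φ θ (α k) ∂(H' k : Measure T) -
        ∫ ω, ∫ θ, φ θ (sel ω) ∂(H ω : Measure T) ∂P| ≤ e₁ * P.real univ + D * e ∧
      |∑ k, c k * optimalPayoff uR (H' k) - ∫ ω, optimalPayoff uR (H ω) ∂P| ≤
        e * P.real univ + D * e := by
  classical
  have hD0 : 0 ≤ D := by
    obtain ⟨ω⟩ := ‹Nonempty Ω›
    exact (abs_nonneg _).trans (hRD (H ω))
  have hφc : ∀ b, Continuous fun θ => φ θ b := fun b =>
    (continuous_eval_const b).comp φ.continuous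
  have hφi : ∀ b (μ : Measure T) [IsFiniteMeasure μ], Integrable (fun θ => φ θ b) μ := fun b μ _ =>
    integrable_continuousMap ⟨_, hφc b⟩ _
  let V : Ω → Set (ProbabilityMeasure T) := fun ω =>
    {G | bestResponse uR G ⊆ Metric.ball (sel ω) δ} ∩
      {G | |optimalPayoff uR G - optimalPayoff uR (H ω)| < e / 2}
  have hV : ∀ ω, V ω ∈ 𝓝 (H ω) := fun ω => inter_mem
    (h_cont.upperHemicontinuous_bestResponse.forall_isOpen (H ω) _ Metric.isOpen_ball (hsel ω))
    (h_cont.continuous_optimalPayoff.continuousAt.preimage_mem_nhds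
      (Metric.ball_mem_nhds _ (half_pos he)))
  obtain ⟨o, s, r, hsub, hcov⟩ := exists_seq_testBall_cover H hV
  let W : ℕ → Set Ω := disjointed fun n => H ⁻¹' testBall (s n) (r n) (H (o n))
  have hWm : ∀ n, MeasurableSet (W n) := fun n =>
    MeasurableSet.disjointed (fun n => hH (measurableSet_testBall _ _ _)) n
  have hWd : Pairwise (Function.onFun Disjoint W) := disjoint_disjointed _
  have hWU : ⋃ n, W n = univ := by
    rw [iUnion_disjointed, eq_univ_iff_forall]
    exact fun ω => mem_iUnion.2 (hcov ω)
  have hWs : ∀ n, ∀ ω ∈ W n, H ω ∈ testBall (s n) (r n) (H (o n)) := fun n ω hω =>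
    disjointed_subset _ n hω
  obtain ⟨m, hm⟩ : ∃ m, P (accumulate W m)ᶜ ≤ ENNReal.ofReal e := by
    have ht := tendsto_measure_iUnion_accumulate (μ := P) (f := W)
    rw [hWU] at ht
    have ht2 := ENNReal.Tendsto.sub (tendsto_const_nhds (x := P univ)) ht
      (Or.inl (measure_ne_top _ _))
    rw [tsub_self] at ht2
    obtain ⟨m, hm⟩ := (ht2.eventually (gt_mem_nhds (ENNReal.ofReal_pos.2 he))).exists
    refine ⟨m, ?_⟩
    have hacc : MeasurableSet (accumulate W m) := by
      rw [accumulate_def]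
      exact MeasurableSet.biUnion (to_countable _) fun n _ => hWm n
    rw [measure_compl hacc (measure_ne_top _ _)]
    exact hm.le
  let t : Finset ℕ := (Finset.range (m + 1)).filter fun n => P (W n) ≠ 0
  have htP : ∀ k : t, P (W k) ≠ 0 := fun k => (Finset.mem_filter.1 k.2).2
  let Q : Set Ω := ⋃ k : t, W k
  have hWmt : ∀ k : t, MeasurableSet (W k) := fun k => hWm k
  have hWdt : Pairwise (Function.onFun Disjoint fun k : t => W k) := fun k l hkl =>
    hWd fun h => hkl (Subtype.ext h)
  have hQm : MeasurableSet Q := MeasurableSet.iUnion hWmt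
  have hQe : P.real Qᶜ ≤ e := by
    have hsubQ : Qᶜ ⊆ (accumulate W m)ᶜ ∪ ⋃ n ∈ {n | P (W n) = 0}, W n := by
      intro ω hω
      by_contra hcon
      rw [mem_union, not_or, mem_compl_iff, not_not, mem_accumulate] at hcon
      obtain ⟨⟨n, hn, hωn⟩, hcon⟩ := hcon
      refine hω (mem_iUnion.2 ⟨⟨n, Finset.mem_filter.2 ⟨Finset.mem_range_succ_iff.2 hn, ?_⟩⟩, hωn⟩)
      exact fun h => hcon (mem_iUnion₂.2 ⟨n, h, hωn⟩)
    refine ENNReal.toReal_le_of_le_ofReal he.le ((measure_mono hsubQ).trans ?_)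
    refine (measure_union_le _ _).trans ?_
    have hnull : P (⋃ n ∈ {n | P (W n) = 0}, W n) = 0 :=
      (measure_biUnion_null_iff (to_countable _)).2 fun n hn => hn
    rw [hnull, add_zero]
    exact hm
  have hsum : ∀ ψ : Ω → ℝ, Measurable ψ → (∀ ω, |ψ ω| ≤ D) →
      |∑ k : t, ∫ ω in W k, ψ ω ∂P - ∫ ω, ψ ω ∂P| ≤ D * e := by
    intro ψ hψm hψD
    have hψ : Integrable ψ P := Integrable.of_bound hψm.aestronglyMeasurable D (.of_forall hψD)
    rw [← integral_iUnion_fintype hWmt hWdt fun k => hψ.integrableOn,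
      ← integral_add_compl hQm hψ, sub_add_cancel_left, abs_neg, ← Real.norm_eq_abs]
    exact (norm_setIntegral_le_of_norm_le_const (measure_lt_top _ _) fun ω _ => hψD ω).trans
      (mul_le_mul_of_nonneg_left hQe hD0)
  have hmassQ : ∑ k : t, P.real (W k) = P.real Q := by
    rw [measureReal_def, measure_iUnion hWdt hWmt, tsum_fintype, ENNReal.toReal_sum
      fun k _ => measure_ne_top _ _]
    rfl
  have hmassle : ∑ k : t, P.real (W k) ≤ P.real univ := by
    rw [hmassQ]; exact measureReal_mono (subset_univ _)
  have hcombine : ∀ (x : t → ℝ) (ψ : Ω → ℝ) (κ : ℝ), 0 ≤ κ →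
      (∀ k : t, |P.real (W k) * x k - ∫ ω in W k, ψ ω ∂P| ≤ κ * P.real (W k)) →
      |∑ k : t, ∫ ω in W k, ψ ω ∂P - ∫ ω, ψ ω ∂P| ≤ D * e →
      |∑ k : t, P.real (W k) * x k - ∫ ω, ψ ω ∂P| ≤ κ * P.real univ + D * e := by
    intro x ψ κ hκ hcell htot
    refine (abs_sub_le _ (∑ k : t, ∫ ω in W k, ψ ω ∂P) _).trans (add_le_add ?_ htot)
    rw [← Finset.sum_sub_distrib]
    refine (Finset.abs_sum_le_sum_abs _ _).trans ((Finset.sum_le_sum fun k _ => hcell k).trans ?_)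
    rw [← Finset.mul_sum]
    exact mul_le_mul_of_nonneg_left hmassle hκ
  let H' : t → ProbabilityMeasure T := fun k =>
    ⟨mixture P hH (W k), isProbabilityMeasure_mixture hH (htP k)⟩
  have hH'V : ∀ k : t, H' k ∈ V (o k) := fun k =>
    hsub k (mixture_mem_testBall hH (htP k) (hWs k))
  have hcoe : ∀ k : t, (((P (W k)).toNNReal : ℝ≥0) : ℝ) = P.real (W k) := fun k => rfl
  refine ⟨t, inferInstance, fun k => (P (W k)).toNNReal, H', fun k => sel (o k), ?_, ?_, ?_, ?_,
    ?_, ?_⟩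
  · exact fun k => ENNReal.toNNReal_pos (htP k) (measure_ne_top _ _)
  · refine le_trans ?_ hbar
    refine Measure.le_iff.2 fun B hB => ?_
    have h1 : ∀ k : t, ((P (W k)).toNNReal • (H' k : Measure T)) =
        beliefKernel H hH ∘ₘ P.restrict (W k) := fun k => smul_mixture hH (htP k)
    simp_rw [h1]
    rw [Measure.finsetSum_apply, Measure.bind_apply hB (Kernel.measurable _).aemeasurable]
    simp_rw [Measure.bind_apply hB (Kernel.measurable _).aemeasurable]
    have h2 := lintegral_iUnion hWmt hWdt (μ := P) fun ω => beliefKernel H hH ω B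
    rw [tsum_fintype] at h2
    rw [← h2]
    exact setLIntegral_le_lintegral _ _
  · exact fun k => (hH'V k).1
  · simp_rw [hcoe]
    rw [hmassQ]
    have := measureReal_add_measureReal_compl (μ := P) hQm
    linarith
  · have hbd : ∀ (b : Ω → A) ω, |∫ θ, φ θ (b ω) ∂(H ω : Measure T)| ≤ D := fun b ω => by
      have := norm_integral_le_of_norm_le_const (μ := (H ω : Measure T))
        (f := fun θ => φ θ (b ω)) (.of_forall fun θ => hφD θ (b ω))
      simpa using this
    have hcell : ∀ k : t, |P.real (W k) * ∫ θ, φ θ (sel (o k)) ∂(H' k : Measure T) -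
        ∫ ω in W k, ∫ θ, φ θ (sel ω) ∂(H ω : Measure T) ∂P| ≤ e₁ * P.real (W k) := by
      intro k
      have h2 : P.real (W k) * ∫ θ, φ θ (sel (o k)) ∂(H' k : Measure T) =
          ∫ ω in W k, ∫ θ, φ θ (sel (o k)) ∂(H ω : Measure T) ∂P :=
        measureReal_mul_integral_mixture hH (htP k) (hφi _ _)
      have h3 : Measurable fun ω => ∫ θ, φ θ (sel (o k)) ∂(H ω : Measure T) :=
        measurable_integral_belief hH (f := fun _ θ => φ θ (sel (o k)))
          ((hφc _).measurable.comp measurable_snd)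
      rw [h2, ← integral_sub
        (Integrable.of_bound h3.aestronglyMeasurable D (.of_forall (hbd fun _ => sel (o k))))
        (Integrable.of_bound hφm.aestronglyMeasurable D (.of_forall (hbd sel))),
        ← Real.norm_eq_abs]
      refine norm_setIntegral_le_of_norm_le_const (measure_lt_top _ _) fun ω hω => ?_
      rw [← integral_sub (hφi _ _) (hφi _ _)]
      -- Both actions are within `δ` of the best responses to `H ω`.
      obtain ⟨b, hb⟩ := h_cont.nonempty_bestResponse (H ω)
      have h4 : dist b (sel (o k)) < δ := (hsub k (hWs k ω hω)).1 hb
      have h5 : dist b (sel ω) < δ := hsel ω hb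
      have h6 : dist (sel (o k)) (sel ω) < 2 * δ := by
        linarith [dist_triangle_left (sel (o k)) (sel ω) b]
      have := norm_integral_le_of_norm_le_const (μ := (H ω : Measure T))
        (f := fun θ => φ θ (sel (o k)) - φ θ (sel ω)) (.of_forall fun θ => hmod θ _ _ h6)
      simpa using this
    exact hcombine _ _ _ he₁ hcell (hsum _ hφm (hbd sel))
  · have hm : Measurable fun ω => optimalPayoff uR (H ω) :=
      h_cont.continuous_optimalPayoff.measurable.comp hH
    have hcell : ∀ k : t, |P.real (W k) * optimalPayoff uR (H' k) -
        ∫ ω in W k, optimalPayoff uR (H ω) ∂P| ≤ e * P.real (W k) := by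
      intro k
      have h2 : P.real (W k) * optimalPayoff uR (H' k) =
          ∫ _ in W k, optimalPayoff uR (H' k) ∂P := by
        rw [setIntegral_const, smul_eq_mul]
      rw [h2, ← integral_sub (integrable_const _)
        (Integrable.of_bound hm.aestronglyMeasurable D (.of_forall fun ω => hRD (H ω))),
        ← Real.norm_eq_abs]
      refine norm_setIntegral_le_of_norm_le_const (measure_lt_top _ _) fun ω hω => ?_
      have h3 := abs_lt.1 (show |optimalPayoff uR (H' k) - optimalPayoff uR (H (o k))| < e / 2 from
        (hH'V k).2)
      have h4 := abs_lt.1 (show |optimalPayoff uR (H ω) - optimalPayoff uR (H (o k))| < e / 2 from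
        (hsub k (hWs k ω hω)).2)
      rw [Real.norm_eq_abs, abs_le]
      constructor <;> linarith [h3.1, h3.2, h4.1, h4.2]
    exact hcombine _ _ _ he.le hcell (hsum _ hm fun ω => hRD (H ω))

end Discretization

/-! ### Continuous approximation of the sender's payoff -/

section SenderPayoff

variable {T : Type*} [MetricSpace T] [CompactSpace T]
  {A : Type*} [MetricSpace A] [CompactSpace A]

/-- A family of continuous functions that depends measurably on a parameter pointwise is a
strongly measurable family in the uniform norm. -/
lemma stronglyMeasurable_continuousMap {X : Type*} [MeasurableSpace X] {U : X → C(A, ℝ)}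
    (hU : ∀ a, Measurable fun x => U x a) : StronglyMeasurable U := by
  borelize C(A, ℝ)
  refine Measurable.stronglyMeasurable (measurable_of_isOpen fun O hO => ?_)
  choose! r hr hrO using fun g (hg : g ∈ O) =>
    Metric.nhds_basis_closedBall.mem_iff.1 (hO.mem_nhds hg)
  obtain ⟨t, htO, htc, ht⟩ := TopologicalSpace.countable_cover_nhdsWithin
    (f := fun g => Metric.closedBall g (r g))
    fun g hg => mem_nhdsWithin_of_mem_nhds (Metric.closedBall_mem_nhds g (hr g hg))
  have hO' : O = ⋃ g ∈ t, Metric.closedBall g (r g) :=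
    Subset.antisymm ht (iUnion₂_subset fun g hg => hrO g (htO hg))
  rw [hO', preimage_iUnion₂]
  refine MeasurableSet.biUnion htc fun g hg => ?_
  have hball : U ⁻¹' Metric.closedBall g (r g) =
      ⋂ a ∈ TopologicalSpace.exists_countable_dense A |>.choose,
        {x | dist (U x a) (g a) ≤ r g} := by
    obtain ⟨hSc, hSd⟩ := (TopologicalSpace.exists_countable_dense A).choose_spec
    ext x
    simp only [mem_preimage, Metric.mem_closedBall, mem_iInter₂, mem_ofPred_eq]
    rw [ContinuousMap.dist_le (hr g (htO hg)).le]
    refine ⟨fun h a _ => h a, fun h a => ?_⟩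
    have hcl : IsClosed {a | dist (U x a) (g a) ≤ r g} :=
      isClosed_le ((U x).continuous.dist g.continuous) continuous_const
    exact hcl.closure_subset_iff.2 (fun a ha => h a ha) (hSd a)
  rw [hball]
  refine MeasurableSet.biInter
    (TopologicalSpace.exists_countable_dense A).choose_spec.1 fun a _ => ?_
  exact measurableSet_le ((hU a).dist measurable_const) measurable_const

/-- Equicontinuity in the action, uniformly over types. -/
lemma exists_dist_lt_forall_abs_sub_le (φ : C(T, C(A, ℝ))) {e : ℝ} (he : 0 < e) :
    ∃ δ > 0, ∀ θ a b, dist a b < δ → |φ θ a - φ θ b| ≤ e := by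
  have hc : Continuous fun p : T × A => φ p.1 p.2 := by fun_prop
  obtain ⟨δ, hδ, h⟩ := Metric.uniformContinuous_iff.1
    (CompactSpace.uniformContinuous_of_continuous hc) e he
  refine ⟨δ, hδ, fun θ a b hab => ?_⟩
  have := h (a := (θ, a)) (b := (θ, b)) (by simpa [Prod.dist_eq] using hab)
  exact this.le

variable [MeasurableSpace T] [BorelSpace T]

/-- The sender's payoff is approximated, uniformly over actions and in mean over types, by a
jointly continuous one. -/
lemma exists_continuous_sender_approx {F : ProbabilityMeasure T} {uS uR : A → T → ℝ}
    (hu : RegularPayoffs F uS uR) {e : ℝ} (he : 0 < e) :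
    ∃ (φ : C(T, C(A, ℝ))) (h : T → ℝ), Integrable h (F : Measure T) ∧
      (∀ b θ, |uS b θ - φ θ b| ≤ h θ) ∧ ∫ θ, h θ ∂(F : Measure T) ≤ e := by
  let U : T → C(A, ℝ) := fun θ => ⟨fun a => uS a θ, hu.continuous_sender θ⟩
  obtain ⟨g, hg, hug⟩ := hu.envelope_sender
  have hUi : Integrable U (F : Measure T) :=
    ⟨(stronglyMeasurable_continuousMap fun a => hu.measurable_sender a).aestronglyMeasurable,
      ContinuousMap.hasFiniteIntegral_of_bound U g hg.2 (.of_forall fun θ a => hug a θ)⟩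
  obtain ⟨φ, hφ, hφi⟩ := hUi.exists_boundedContinuous_integral_sub_le he
  refine ⟨φ.toContinuousMap, fun θ => ‖U θ - φ θ‖, (hUi.sub hφi).norm, fun b θ => ?_, hφ⟩
  exact (U θ - φ θ).norm_coe_le_norm b

end SenderPayoff

/-! ### Perturbed beliefs -/

section BoundedDensity

variable {T : Type*} [MeasurableSpace T]

/-- A belief with density at most `1 + η` relative to another one gives nearly the same
expectations. -/
lemma abs_integral_sub_le_of_le_smul {G G' : ProbabilityMeasure T} {η : ℝ} (hη : 0 ≤ η)
    (hle : (G' : Measure T) ≤ ENNReal.ofReal (1 + η) • (G : Measure T)) {f : T → ℝ}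
    (hf : Measurable f) {D : ℝ} (hD : ∀ θ, |f θ| ≤ D) :
    |∫ θ, f θ ∂(G' : Measure T) - ∫ θ, f θ ∂(G : Measure T)| ≤ 2 * η * D := by
  have hi : ∀ μ : ProbabilityMeasure T, Integrable f (μ : Measure T) := fun μ =>
    Integrable.of_bound hf.aestronglyMeasurable D (.of_forall hD)
  have key : ∀ g : T → ℝ, (∀ μ : ProbabilityMeasure T, Integrable g (μ : Measure T)) →
      (∀ θ, 0 ≤ g θ) → ∫ θ, g θ ∂(G' : Measure T) ≤ (1 + η) * ∫ θ, g θ ∂(G : Measure T) := by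
    intro g hg h0
    have h1 := integral_mono_measure hle (.of_forall h0)
      ((hg G).smul_measure ENNReal.ofReal_ne_top)
    rwa [integral_smul_measure, ENNReal.toReal_ofReal (by linarith), smul_eq_mul] at h1
  have h1 := key (fun θ => D - f θ) (fun μ => (integrable_const D).sub (hi μ))
    fun θ => by linarith [(abs_le.1 (hD θ)).2]
  have h2 := key (fun θ => D + f θ) (fun μ => (integrable_const D).add (hi μ))
    fun θ => by linarith [(abs_le.1 (hD θ)).1]
  have h3 : |∫ θ, f θ ∂(G : Measure T)| ≤ D := by
    have := norm_integral_le_of_norm_le_const (μ := (G : Measure T)) (f := f) (.of_forall hD)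
    simpa using this
  rw [integral_sub (integrable_const D) (hi _), integral_sub (integrable_const D) (hi _)] at h1
  rw [integral_add (integrable_const D) (hi _), integral_add (integrable_const D) (hi _)] at h2
  simp only [integral_const, probReal_univ, smul_eq_mul, one_mul] at h1 h2
  rw [abs_le] at *
  constructor <;> nlinarith

lemma le_smul_of_rnDeriv_le {G G' : ProbabilityMeasure T} {c : ℝ≥0∞}
    (hac : (G' : Measure T) ≪ (G : Measure T))
    (hle : ∀ᵐ θ ∂(G : Measure T), (G' : Measure T).rnDeriv (G : Measure T) θ ≤ c) :
    (G' : Measure T) ≤ c • (G : Measure T) := by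
  rw [← Measure.withDensity_rnDeriv_eq _ _ hac, ← withDensity_const]
  exact withDensity_mono hle

end BoundedDensity

section Perturbation

variable {T : Type*} [MetricSpace T] [CompactSpace T] [MeasurableSpace T] [BorelSpace T]
  {A : Type*} [MetricSpace A] {uS uR : A → T → ℝ} {sel : ProbabilityMeasure T → A}

/-- A selection from the best responses that can be enforced by measurable perturbations of the
belief is itself measurable: it lies in a closed set exactly if the best responses to all
perturbations come close to that set, which by upper hemicontinuity is a measurable condition. -/
lemma measurable_of_canPerturbTo [MeasurableSpace A] [BorelSpace A]
    (h_cont : ContinuityConditions uS uR) (h : CanPerturbTo uR sel) : Measurable sel := by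
  have hpos : ∀ n : ℕ, (0 : ℝ) < 1 / ((n : ℝ) + 1) := fun n => Nat.one_div_pos_of_nat
  choose t htm ht using fun n : ℕ => h _ (hpos n) _ (hpos n)
  refine measurable_of_isClosed fun C hC => ?_
  have heq : sel ⁻¹' C = ⋂ n, {G | (bestResponse uR (t n G) ∩
      Metric.cthickening (1 / ((n : ℝ) + 1)) C).Nonempty} := by
    ext G
    simp only [mem_preimage, mem_iInter, mem_ofPred_eq]
    constructor
    · intro hG n
      obtain ⟨b, hb⟩ := h_cont.nonempty_bestResponse (t n G)
      exact ⟨b, hb, Metric.mem_cthickening_of_dist_le b (sel G) _ C hG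
        (le_of_lt ((ht n G).2.2 hb))⟩
    · intro hG
      have hle : ∀ n : ℕ, Metric.infDist (sel G) C ≤ 2 * (1 / ((n : ℝ) + 1)) := by
        intro n
        obtain ⟨b, hb, hbC⟩ := hG n
        have h1 : dist b (sel G) < 1 / ((n : ℝ) + 1) := (ht n G).2.2 hb
        have h2 := Metric.infDist_le_infDist_add_dist (s := C) (x := sel G) (y := b)
        have h3 : Metric.infDist b C ≤ 1 / ((n : ℝ) + 1) := by
          rw [Metric.infDist]
          exact ENNReal.toReal_le_of_le_ofReal (hpos n).le hbC
        rw [dist_comm] at h1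
        linarith
      have hne : C.Nonempty := by
        obtain ⟨b, _, hbC⟩ := hG 0
        by_contra hC
        rw [not_nonempty_iff_eq_empty.1 hC, Metric.cthickening_empty] at hbC
        exact hbC
      have hlim : Tendsto (fun n : ℕ => 2 * (1 / ((n : ℝ) + 1))) atTop (𝓝 0) := by
        simpa using (tendsto_one_div_add_atTop_nhds_zero_nat (𝕜 := ℝ)).const_mul 2
      have h0 : Metric.infDist (sel G) C ≤ 0 := ge_of_tendsto' hlim hle
      rw [hC.mem_iff_infDist_zero hne]
      exact le_antisymm h0 Metric.infDist_nonneg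
  rw [heq]
  refine MeasurableSet.iInter fun n => ?_
  have hcl : IsClosed {G : ProbabilityMeasure T | (bestResponse uR G ∩
      Metric.cthickening (1 / ((n : ℝ) + 1)) C).Nonempty} := by
    have := upperHemicontinuous_iff_isClosed_compl_preimage_Iic_compl.1
      h_cont.upperHemicontinuous_bestResponse _ (Metric.isClosed_cthickening (E := C)
        (δ := 1 / ((n : ℝ) + 1)))
    convert! this using 1
    ext G
    simp only [mem_ofPred_eq, mem_compl_iff, mem_preimage, mem_Iic,
      subset_compl_iff_disjoint_right, not_disjoint_iff_nonempty_inter]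
  exact htm n hcl.measurableSet

/-- Perturbations of the belief of size `1 / (n + 1)` that enforce the selection `sel` up to a
distance of `1 / (n + 1)`. The receiver's expected payoff is asymptotically unaffected. -/
lemma exists_seq_perturbation (h_cont : ContinuityConditions uS uR) (h : CanPerturbTo uR sel)
    (σ : ProbabilityMeasure (ProbabilityMeasure T)) {D : ℝ} (hRD : ∀ G, |optimalPayoff uR G| ≤ D) :
    ∃ t : ℕ → ProbabilityMeasure T → ProbabilityMeasure T, (∀ n, Measurable (t n)) ∧
      (∀ n G, (t n G : Measure T) ≤ ENNReal.ofReal (1 + 1 / ((n : ℝ) + 1)) • (G : Measure T)) ∧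
      (∀ n G, bestResponse uR (t n G) ⊆ Metric.ball (sel G) (1 / ((n : ℝ) + 1))) ∧
      Tendsto (fun n => ∫ G, optimalPayoff uR (t n G) ∂(σ : Measure (ProbabilityMeasure T))) atTop
        (𝓝 (∫ G, optimalPayoff uR G ∂(σ : Measure (ProbabilityMeasure T)))) := by
  have hpos : ∀ n : ℕ, (0 : ℝ) < 1 / ((n : ℝ) + 1) := fun n => Nat.one_div_pos_of_nat
  choose t htm ht using fun n : ℕ => h _ (hpos n) _ (hpos n)
  have hle : ∀ n G, (t n G : Measure T) ≤
      ENNReal.ofReal (1 + 1 / ((n : ℝ) + 1)) • (G : Measure T) := fun n G =>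
    le_smul_of_rnDeriv_le (ht n G).1 (ht n G).2.1
  refine ⟨t, htm, hle, fun n G => (ht n G).2.2, ?_⟩
  have hUm := h_cont.continuous_optimalPayoff.measurable
  refine tendsto_integral_of_dominated_convergence (fun _ => D)
    (fun n => (hUm.comp (htm n)).aestronglyMeasurable) (integrable_const _)
    (fun n => .of_forall fun G => hRD _) (.of_forall fun G => ?_)
  have hconv : Tendsto (fun n => t n G) atTop (𝓝 G) := by
    rw [ProbabilityMeasure.tendsto_iff_forall_integral_tendsto]
    intro f
    rw [tendsto_iff_norm_sub_tendsto_zero]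
    have hlim : Tendsto (fun n : ℕ => 2 * (1 / ((n : ℝ) + 1)) * ‖f‖) atTop (𝓝 0) := by
      simpa using ((tendsto_one_div_add_atTop_nhds_zero_nat (𝕜 := ℝ)).const_mul 2).mul_const ‖f‖
    refine squeeze_zero (fun _ => norm_nonneg _) (fun n => ?_) hlim
    exact abs_integral_sub_le_of_le_smul (hpos n).le (hle n G) f.continuous.measurable
      fun θ => f.norm_coe_le_norm θ
  exact (h_cont.continuous_optimalPayoff.tendsto G).comp hconv

end Perturbation

/-! ### Segmentations -/

section Segmentation

variable {T : Type*} [MeasurableSpace T] {F : ProbabilityMeasure T}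

lemma IsSegmentation.comp_eq {σ : ProbabilityMeasure (ProbabilityMeasure T)}
    (hσ : IsSegmentation F σ) :
    beliefKernel id measurable_id ∘ₘ (σ : Measure (ProbabilityMeasure T)) = F := by
  ext B hB
  rw [Measure.bind_apply hB (Kernel.measurable _).aemeasurable]
  exact hσ B hB

lemma IsSegmentation.ae_integrable {σ : ProbabilityMeasure (ProbabilityMeasure T)}
    (hσ : IsSegmentation F σ) {h : T → ℝ} (hh : Integrable h (F : Measure T)) :
    ∀ᵐ G : ProbabilityMeasure T ∂(σ : Measure (ProbabilityMeasure T)),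
      Integrable h (G : Measure T) := by
  rw [← hσ.comp_eq] at hh
  exact Measure.ae_integrable_of_integrable_comp hh

lemma IsSegmentation.integrable_integral {σ : ProbabilityMeasure (ProbabilityMeasure T)}
    (hσ : IsSegmentation F σ) {h : T → ℝ} (hh : Integrable h (F : Measure T)) :
    Integrable (fun G : ProbabilityMeasure T => ∫ θ, h θ ∂(G : Measure T))
      (σ : Measure (ProbabilityMeasure T)) := by
  have h1 := hh
  rw [← hσ.comp_eq, ← Measure.snd_compProd, Measure.snd] at h1
  have h2 := (integrable_map_measure h1.aestronglyMeasurable measurable_snd.aemeasurable).1 h1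
  exact Integrable.integral_compProd h2

lemma IsSegmentation.integral_integral {σ : ProbabilityMeasure (ProbabilityMeasure T)}
    (hσ : IsSegmentation F σ) {h : T → ℝ} (hh : Integrable h (F : Measure T)) :
    ∫ G : ProbabilityMeasure T, ∫ θ, h θ ∂(G : Measure T) ∂(σ : Measure (ProbabilityMeasure T)) =
      ∫ θ, h θ ∂(F : Measure T) := by
  have h1 := hh
  rw [← hσ.comp_eq] at h1
  have h2 := integral_kernel_comp_measure _ _ h1
  rw [hσ.comp_eq] at h2
  exact h2.symm

/-- Two perturbations of a segmentation whose densities are at most `c`, taken with total weight at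
most `1 / c`, have a mixture that is dominated by the prior. -/
lemma comp_sumElim_le {σ : ProbabilityMeasure (ProbabilityMeasure T)} (hσ : IsSegmentation F σ)
    {t₁ t₂ : ProbabilityMeasure T → ProbabilityMeasure T} (h₁ : Measurable t₁) (h₂ : Measurable t₂)
    {c : ℝ≥0∞} (hle₁ : ∀ G, (t₁ G : Measure T) ≤ c • (G : Measure T))
    (hle₂ : ∀ G, (t₂ G : Measure T) ≤ c • (G : Measure T)) {p q : ℝ≥0}
    (hpq : (p + q : ℝ≥0∞) * c ≤ 1) :
    beliefKernel (Sum.elim t₁ t₂) (h₁.sumElim h₂) ∘ₘ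
      (p • (σ : Measure (ProbabilityMeasure T)).map Sum.inl +
        q • (σ : Measure (ProbabilityMeasure T)).map Sum.inr) ≤ (F : Measure T) := by
  refine Measure.le_iff.2 fun B hB => ?_
  have hm : Measurable fun ω => beliefKernel (Sum.elim t₁ t₂) (h₁.sumElim h₂) ω B :=
    Kernel.measurable_coe _ hB
  have hbd : ∀ t : ProbabilityMeasure T → ProbabilityMeasure T,
      (∀ G, (t G : Measure T) ≤ c • (G : Measure T)) →
      ∫⁻ G, (t G : Measure T) B ∂(σ : Measure (ProbabilityMeasure T)) ≤ c * (F : Measure T) B := by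
    intro t ht
    have hmeas : Measurable fun G : ProbabilityMeasure T => (G : Measure T) B :=
      (Measure.measurable_coe hB).comp measurable_subtype_coe
    rw [← hσ B hB, ← lintegral_const_mul c hmeas]
    exact lintegral_mono fun G => by simpa using ht G B
  rw [Measure.bind_apply hB (Kernel.measurable _).aemeasurable, lintegral_add_measure,
    lintegral_smul_measure, lintegral_smul_measure, lintegral_map hm measurable_inl,
    lintegral_map hm measurable_inr]
  calc _ ≤ (p : ℝ≥0∞) * (c * (F : Measure T) B) + (q : ℝ≥0∞) * (c * (F : Measure T) B) :=
        add_le_add (mul_le_mul_right (hbd t₁ hle₁) _) (mul_le_mul_right (hbd t₂ hle₂) _)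
    _ = ((p + q : ℝ≥0∞) * c) * (F : Measure T) B := by ring
    _ ≤ (F : Measure T) B := by
        calc _ ≤ 1 * (F : Measure T) B := mul_le_mul_left hpq _
          _ = _ := one_mul _

end Segmentation

/-- The error of a weighted payoff `l * y` when the weight is divided by `1 + η` and the payoff `y`
is replaced by a nearby one. -/
lemma abs_div_mul_sub_mul_le {l η x y D r : ℝ} (hl : 0 ≤ l) (hη : 0 ≤ η) (hx : |x| ≤ D)
    (hxy : |x - y| ≤ r) : |l / (1 + η) * x - l * y| ≤ l * (η * D + r) := by
  have hη1 : 0 < 1 + η := by linarith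
  have h1 : l / (1 + η) * x - l * y = l * (-(η / (1 + η)) * x + (x - y)) := by
    field_simp
    ring
  have h2 : η / (1 + η) ≤ η := div_le_self hη (by linarith)
  have h3 : |-(η / (1 + η)) * x| ≤ η * D := by
    rw [abs_mul, abs_neg, abs_of_nonneg (by positivity)]
    exact mul_le_mul h2 hx (abs_nonneg _) hη
  rw [h1, abs_mul, abs_of_nonneg hl]
  exact mul_le_mul_of_nonneg_left ((abs_add_le _ _).trans (add_le_add h3 hxy)) hl

/-! ### Achievable profiles -/

section Main

variable {T : Type*} [MetricSpace T] [CompactSpace T] [MeasurableSpace T] [BorelSpace T]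
  {A : Type*} [MetricSpace A] [CompactSpace A] [MeasurableSpace A] [BorelSpace A]
  {F : ProbabilityMeasure T} {uS uR : A → T → ℝ} {aStar : T → A}

/-- Along a measurable action rule, the sender's payoff from a segmentation is well defined, and it
is close to that computed from a mean approximation of the payoff function. -/
lemma sender_payoff_approx (hu : RegularPayoffs F uS uR)
    {σ : ProbabilityMeasure (ProbabilityMeasure T)}
    (hσ : IsSegmentation F σ) {φ : C(T, C(A, ℝ))} {h : T → ℝ} (hh : Integrable h (F : Measure T))
    (hφ : ∀ b θ, |uS b θ - φ θ b| ≤ h θ) {D : ℝ} (hφD : ∀ θ b, |φ θ b| ≤ D)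
    {sel : ProbabilityMeasure T → A} (hsel : Measurable sel) :
    Integrable (fun G : ProbabilityMeasure T => ∫ θ, uS (sel G) θ ∂(G : Measure T))
      (σ : Measure (ProbabilityMeasure T)) ∧
    |∫ G : ProbabilityMeasure T, ∫ θ, φ θ (sel G) ∂(G : Measure T)
        ∂(σ : Measure (ProbabilityMeasure T)) -
      ∫ G : ProbabilityMeasure T, ∫ θ, uS (sel G) θ ∂(G : Measure T)
        ∂(σ : Measure (ProbabilityMeasure T))| ≤ ∫ θ, h θ ∂(F : Measure T) := by
  have hφc : ∀ b, Continuous fun θ => φ θ b := fun b =>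
    (continuous_eval_const b).comp φ.continuous
  have hSm : Measurable fun p : ProbabilityMeasure T × T => uS (sel p.1) p.2 := by
    have h1 : Measurable (Function.uncurry uS) :=
      measurable_uncurry_of_continuous_of_measurable (fun θ => hu.continuous_sender θ)
        hu.measurable_sender
    exact h1.comp ((hsel.comp measurable_fst).prodMk measurable_snd)
  have hSm' := measurable_integral_belief measurable_id (f := fun G θ => uS (sel G) θ) hSm
  have hφm : Measurable fun p : ProbabilityMeasure T × T => φ p.2 (sel p.1) := by
    have h1 : Continuous fun q : A × T => φ q.2 q.1 := by fun_prop
    exact h1.measurable.comp ((hsel.comp measurable_fst).prodMk measurable_snd)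
  have hφm' := measurable_integral_belief measurable_id (f := fun G θ => φ θ (sel G)) hφm
  have hφi : Integrable (fun G : ProbabilityMeasure T => ∫ θ, φ θ (sel G) ∂(G : Measure T))
      (σ : Measure (ProbabilityMeasure T)) := by
    refine Integrable.of_bound hφm'.aestronglyMeasurable D (.of_forall fun G => ?_)
    have := norm_integral_le_of_norm_le_const (μ := (G : Measure T))
      (f := fun θ => φ θ (sel G)) (.of_forall fun θ => hφD θ (sel G))
    simpa using this
  have hdiff : ∀ᵐ G : ProbabilityMeasure T ∂(σ : Measure (ProbabilityMeasure T)),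
      ‖∫ θ, φ θ (sel G) ∂(G : Measure T) - ∫ θ, uS (sel G) θ ∂(G : Measure T)‖ ≤
        ∫ θ, h θ ∂(G : Measure T) := by
    filter_upwards [hσ.ae_integrable hh] with G hG
    have hφG : Integrable (fun θ => φ θ (sel G)) (G : Measure T) :=
      integrable_continuousMap ⟨_, hφc (sel G)⟩ _
    rw [← integral_sub hφG (hu.integrable_sender _ G)]
    refine norm_integral_le_of_norm_le hG (.of_forall fun θ => ?_)
    rw [Real.norm_eq_abs, abs_sub_comm]
    exact hφ _ θ
  have hdi : Integrable (fun G : ProbabilityMeasure T =>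
      ∫ θ, φ θ (sel G) ∂(G : Measure T) - ∫ θ, uS (sel G) θ ∂(G : Measure T))
      (σ : Measure (ProbabilityMeasure T)) :=
    (hσ.integrable_integral hh).mono' (hφm'.sub hSm').aestronglyMeasurable hdiff
  have hSi : Integrable (fun G : ProbabilityMeasure T => ∫ θ, uS (sel G) θ ∂(G : Measure T))
      (σ : Measure (ProbabilityMeasure T)) := by
    refine (hφi.sub hdi).congr (.of_forall fun G => ?_)
    simp
  refine ⟨hSi, ?_⟩
  rw [← integral_sub hφi hSi, ← hσ.integral_integral hh, ← Real.norm_eq_abs]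
  exact norm_integral_le_of_norm_le (hσ.integrable_integral hh) hdiff

/-- The approximation result over any compact metric space of types with an atomless prior. -/
theorem exists_supportable_of_achievable [NullSingletonClass (F : Measure T)]
    (hu : RegularPayoffs F uS uR)
    (haStar : IsCompleteInfoAction uS uR aStar) (h_noRents : NoRents uS uR aStar)
    (h_worstCase : HasWorstCaseTypes uS aStar) (h_cont : ContinuityConditions uS uR)
    {vS vR : ℝ} (h_achievable : Achievable F uS uR vS vR) {ε : ℝ} (hε : 0 < ε) :
    ∃ wS wR : ℝ, Supportable F uS uR wS wR ∧ |wS - vS| < ε ∧ |wR - vR| < ε := by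
  obtain ⟨σ, a, hσ, -, ha, hSi, -, rfl, rfl⟩ := h_achievable
  obtain ⟨aLow, haLow, hpLow⟩ := h_cont.perturb_low
  obtain ⟨aHigh, haHigh, hpHigh⟩ := h_cont.perturb_high
  have hLm := measurable_of_canPerturbTo h_cont hpLow
  have hHm := measurable_of_canPerturbTo h_cont hpHigh
  obtain ⟨φ, h, hh, hφ, hhe⟩ := exists_continuous_sender_approx hu
    (show 0 < ε / 16 by positivity)
  obtain ⟨C, hC⟩ := isCompact_univ.exists_bound_of_continuousOn
    h_cont.continuous_optimalPayoff.continuousOn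
  obtain ⟨D, hD0, hφD, hRD⟩ : ∃ D : ℝ, 0 ≤ D ∧ (∀ θ b, |φ θ b| ≤ D) ∧
      ∀ G, |optimalPayoff uR G| ≤ D := by
    refine ⟨max ‖φ‖ C, (norm_nonneg φ).trans (le_max_left _ _), fun θ b => ?_, fun G => ?_⟩
    · exact (((φ θ).norm_coe_le_norm b).trans (φ.norm_coe_le_norm θ)).trans (le_max_left _ _)
    · exact (hC G (mem_univ _)).trans (le_max_right _ _)
  obtain ⟨δ, hδ, hmod⟩ := exists_dist_lt_forall_abs_sub_le φ (show 0 < ε / 16 by positivity)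
  obtain ⟨t₁, ht₁m, ht₁le, ht₁b, ht₁U⟩ := exists_seq_perturbation h_cont hpLow σ hRD
  obtain ⟨t₂, ht₂m, ht₂le, ht₂b, ht₂U⟩ := exists_seq_perturbation h_cont hpHigh σ hRD
  -- A perturbation small enough for all estimates.
  obtain ⟨n, hnδ, hnD, hn₁, hn₂⟩ : ∃ n : ℕ, 2 * (1 / ((n : ℝ) + 1)) < δ ∧
      4 * D * (1 / ((n : ℝ) + 1)) < ε / 8 ∧
      |∫ G, optimalPayoff uR (t₁ n G) ∂(σ : Measure (ProbabilityMeasure T)) -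
        ∫ G, optimalPayoff uR G ∂(σ : Measure (ProbabilityMeasure T))| < ε / 8 ∧
      |∫ G, optimalPayoff uR (t₂ n G) ∂(σ : Measure (ProbabilityMeasure T)) -
        ∫ G, optimalPayoff uR G ∂(σ : Measure (ProbabilityMeasure T))| < ε / 8 := by
    have hlim := tendsto_one_div_add_atTop_nhds_zero_nat (𝕜 := ℝ)
    have e1 := (hlim.const_mul 2).eventually (gt_mem_nhds (show 2 * 0 < δ by simpa using hδ))
    have e2 := (hlim.const_mul (4 * D)).eventually
      (gt_mem_nhds (show 4 * D * 0 < ε / 8 by simpa using hε))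
    have e3 := ht₁U.eventually (Metric.ball_mem_nhds _ (show 0 < ε / 8 by positivity))
    have e4 := ht₂U.eventually (Metric.ball_mem_nhds _ (show 0 < ε / 8 by positivity))
    exact (e1.and (e2.and (e3.and e4))).exists
  set η : ℝ := 1 / ((n : ℝ) + 1) with hη
  have hη0 : 0 < η := Nat.one_div_pos_of_nat
  have hη1 : 0 < 1 + η := by linarith
  have hφi : ∀ b (G : ProbabilityMeasure T), |∫ θ, φ θ b ∂(G : Measure T)| ≤ D := fun b G => by
    have := norm_integral_le_of_norm_le_const (μ := (G : Measure T)) (f := fun θ => φ θ b)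
      (.of_forall fun θ => hφD θ b)
    simpa using this
  have hbound : ∀ ψ : ProbabilityMeasure T → ℝ, (∀ G, |ψ G| ≤ D) →
      |∫ G, ψ G ∂(σ : Measure (ProbabilityMeasure T))| ≤ D := fun ψ hψ => by
    have := norm_integral_le_of_norm_le_const (μ := (σ : Measure (ProbabilityMeasure T)))
      (f := ψ) (.of_forall hψ)
    simpa using this
  -- The payoff profile lies between those of the sender-worst and sender-best action rules.
  obtain ⟨hLi, hLφ⟩ := sender_payoff_approx hu hσ hh hφ hφD hLm
  obtain ⟨hHi, hHφ⟩ := sender_payoff_approx hu hσ hh hφ hφD hHm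
  set vL := ∫ G : ProbabilityMeasure T, ∫ θ, uS (aLow G) θ ∂(G : Measure T)
    ∂(σ : Measure (ProbabilityMeasure T))
  set vH := ∫ G : ProbabilityMeasure T, ∫ θ, uS (aHigh G) θ ∂(G : Measure T)
    ∂(σ : Measure (ProbabilityMeasure T))
  set vS := ∫ G : ProbabilityMeasure T, ∫ θ, uS (a G) θ ∂(G : Measure T)
    ∂(σ : Measure (ProbabilityMeasure T))
  have hR : ∫ G : ProbabilityMeasure T, ∫ θ, uR (a G) θ ∂(G : Measure T)
      ∂(σ : Measure (ProbabilityMeasure T)) =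
      ∫ G, optimalPayoff uR G ∂(σ : Measure (ProbabilityMeasure T)) := by
    refine integral_congr_ae ?_
    filter_upwards [ha] with G hG
    exact (optimalPayoff_eq hG).symm
  rw [hR]
  set vR := ∫ G, optimalPayoff uR G ∂(σ : Measure (ProbabilityMeasure T))
  have hLS : vL ≤ vS := integral_mono_ae hLi hSi (by
    filter_upwards [ha] with G hG using (haLow G).2 _ hG)
  have hSH : vS ≤ vH := integral_mono_ae hSi hHi (by
    filter_upwards [ha] with G hG using (haHigh G).2 _ hG)
  obtain ⟨l₁, l₂, hl₁, hl₂, hl, hlv⟩ : vS ∈ segment ℝ vL vH := by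
    rw [segment_eq_Icc (hLS.trans hSH)]
    exact ⟨hLS, hSH⟩
  simp only [smul_eq_mul] at hlv
  let p : ℝ≥0 := ⟨l₁ / (1 + η), by positivity⟩
  let q : ℝ≥0 := ⟨l₂ / (1 + η), by positivity⟩
  have hpq : (p : ℝ) + q = 1 / (1 + η) := by
    change l₁ / (1 + η) + l₂ / (1 + η) = _
    rw [← add_div, hl]
  have hbar := comp_sumElim_le hσ (ht₁m n) (ht₂m n) (ht₁le n) (ht₂le n) (p := p) (q := q) (by
    rw [← ENNReal.coe_add, ← ENNReal.ofReal_coe_nnreal, NNReal.coe_add, hpq,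
      ← ENNReal.ofReal_mul (by positivity), ← hη, one_div_mul_cancel hη1.ne', ENNReal.ofReal_one])
  set P : Measure (ProbabilityMeasure T ⊕ ProbabilityMeasure T) :=
    p • (σ : Measure (ProbabilityMeasure T)).map Sum.inl +
      q • (σ : Measure (ProbabilityMeasure T)).map Sum.inr with hP
  have hPint : ∀ ψ : ProbabilityMeasure T ⊕ ProbabilityMeasure T → ℝ, Measurable ψ →
      (∀ ω, |ψ ω| ≤ D) → ∫ ω, ψ ω ∂P =
        p * ∫ G, ψ (Sum.inl G) ∂(σ : Measure (ProbabilityMeasure T)) +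
        q * ∫ G, ψ (Sum.inr G) ∂(σ : Measure (ProbabilityMeasure T)) := by
    intro ψ hψ hψD
    have hi : ∀ μ : Measure (ProbabilityMeasure T ⊕ ProbabilityMeasure T), IsFiniteMeasure μ →
        Integrable ψ μ := fun μ _ =>
      Integrable.of_bound hψ.aestronglyMeasurable D (.of_forall hψD)
    rw [hP, integral_add_measure (hi _ inferInstance) (hi _ inferInstance),
      integral_smul_nnreal_measure, integral_smul_nnreal_measure,
      integral_map measurable_inl.aemeasurable hψ.aestronglyMeasurable,
      integral_map measurable_inr.aemeasurable hψ.aestronglyMeasurable]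
    rfl
  have hPuniv : P.real univ = 1 / (1 + η) := by
    rw [← hpq, hP, measureReal_add_apply, measureReal_nnreal_smul_apply,
      measureReal_nnreal_smul_apply, map_measureReal_apply measurable_inl .univ,
      map_measureReal_apply measurable_inr .univ, preimage_univ, preimage_univ, probReal_univ,
      mul_one, mul_one]
  have hMle : P.real univ ≤ 1 := by
    rw [hPuniv, div_le_one hη1]
    linarith
  have hMge : 1 - η ≤ P.real univ := by
    rw [hPuniv, le_div_iff₀ hη1]
    nlinarith
  have hφu : Continuous fun r : A × T => φ r.2 r.1 := by fun_prop
  have hsel : ∀ (s : ProbabilityMeasure T → A), Measurable s →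
      ∀ (t : ProbabilityMeasure T → ProbabilityMeasure T), Measurable t →
      Measurable fun G => ∫ θ, φ θ (s G) ∂(t G : Measure T) := fun s hs t ht =>
    measurable_integral_belief ht (f := fun G θ => φ θ (s G))
      (hφu.measurable.comp ((hs.comp measurable_fst).prodMk measurable_snd))
  let H := Sum.elim (t₁ n) (t₂ n)
  let sel := Sum.elim aLow aHigh
  have hHmeas : Measurable H := (ht₁m n).sumElim (ht₂m n)
  have hφm : Measurable fun ω => ∫ θ, φ θ (sel ω) ∂(H ω : Measure T) := by
    convert! (hsel _ hLm _ (ht₁m n)).sumElim (hsel _ hHm _ (ht₂m n)) using 1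
    ext (G | G) <;> rfl
  have hUm : Measurable fun ω => optimalPayoff uR (H ω) :=
    h_cont.continuous_optimalPayoff.measurable.comp hHmeas
  -- Perturbing the beliefs and scaling the weights changes the payoffs little.
  have hpert : ∀ (s : ProbabilityMeasure T → A), Measurable s →
      ∀ (t : ProbabilityMeasure T → ProbabilityMeasure T), Measurable t →
      (∀ G, (t G : Measure T) ≤ ENNReal.ofReal (1 + η) • (G : Measure T)) →
      |∫ G, ∫ θ, φ θ (s G) ∂(t G : Measure T) ∂(σ : Measure (ProbabilityMeasure T)) -
        ∫ G : ProbabilityMeasure T, ∫ θ, φ θ (s G) ∂(G : Measure T)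
          ∂(σ : Measure (ProbabilityMeasure T))| ≤ 2 * η * D := by
    intro s hs t ht hle
    have hint : ∀ t : ProbabilityMeasure T → ProbabilityMeasure T, Measurable t →
        Integrable (fun G => ∫ θ, φ θ (s G) ∂(t G : Measure T))
          (σ : Measure (ProbabilityMeasure T)) := fun t ht =>
      Integrable.of_bound (hsel s hs t ht).aestronglyMeasurable D (.of_forall fun G => hφi _ _)
    have hid := hint id measurable_id
    simp only [id_eq] at hid
    rw [← integral_sub (hint t ht) hid]
    have := norm_integral_le_of_norm_le_const (μ := (σ : Measure (ProbabilityMeasure T)))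
      (f := fun G : ProbabilityMeasure T => ∫ θ, φ θ (s G) ∂(t G : Measure T) -
        ∫ θ, φ θ (s G) ∂(G : Measure T)) (C := 2 * η * D) (.of_forall fun G =>
        abs_integral_sub_le_of_le_smul hη0.le (hle G)
          (hφu.comp (Continuous.prodMk_right (s G))).measurable fun θ => hφD θ _)
    simpa using this
  have hSP : |∫ ω, ∫ θ, φ θ (sel ω) ∂(H ω : Measure T) ∂P - vS| ≤ 3 * η * D + ε / 16 := by
    rw [hPint _ hφm fun ω => hφi _ _, ← hlv]
    have h1 := abs_div_mul_sub_mul_le hl₁ hη0.le (hbound _ fun G => hφi (aLow G) (t₁ n G))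
      ((abs_sub_le _ _ _).trans (add_le_add (hpert _ hLm _ (ht₁m n) (ht₁le n)) hLφ))
    have h2 := abs_div_mul_sub_mul_le hl₂ hη0.le (hbound _ fun G => hφi (aHigh G) (t₂ n G))
      ((abs_sub_le _ _ _).trans (add_le_add (hpert _ hHm _ (ht₂m n) (ht₂le n)) hHφ))
    rw [add_sub_add_comm]
    refine ((abs_add_le _ _).trans (add_le_add h1 h2)).trans ?_
    rw [← add_mul, hl]
    linarith
  have hRP : |∫ ω, optimalPayoff uR (H ω) ∂P - vR| ≤ η * D + ε / 8 := by
    have hvR : vR = l₁ * vR + l₂ * vR := by rw [← add_mul, hl, one_mul]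
    rw [hPint _ hUm fun ω => hRD _, hvR]
    have h1 := abs_div_mul_sub_mul_le hl₁ hη0.le (hbound _ fun G => hRD (t₁ n G)) hn₁.le
    have h2 := abs_div_mul_sub_mul_le hl₂ hη0.le (hbound _ fun G => hRD (t₂ n G)) hn₂.le
    rw [add_sub_add_comm]
    refine ((abs_add_le _ _).trans (add_le_add h1 h2)).trans ?_
    rw [← add_mul, hl, one_mul]
  have hD1 : 0 < D + 1 := by linarith
  set e : ℝ := ε / (16 * (D + 1)) with he
  have he0 : 0 < e := by positivity
  have heD : D * e + e = ε / 16 := by rw [he]; field_simp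
  have : Nonempty (ProbabilityMeasure T) := ⟨F⟩
  obtain ⟨ι, _, c, H', α, hc, hle, hα, hcM, hmixS, hmixR⟩ := exists_finite_mixture h_cont hHmeas
    (sel := sel) (δ := η) (by rintro (G | G); exacts [ht₁b n G, ht₂b n G]) hbar hφD hRD
    (fun θ a b hab => hmod θ a b (hab.trans hnδ)) (by positivity) hφm he0
  obtain ⟨wS, wR, hw, hwS, hwR⟩ := exists_supportable_of_finite hu haStar h_noRents h_worstCase
    h_cont hh hφ hφD hRD (fun θ a b hab => hmod θ a b (hab.trans (by linarith)))
    (by positivity) hc hle hα (show 0 < ε / 8 by positivity)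
  have hDc : D * (1 - ∑ k, (c k : ℝ)) ≤ D * η + D * e := by
    rw [← mul_add]
    exact mul_le_mul_of_nonneg_left (by linarith) hD0
  have hDη : 0 ≤ D * η := by positivity
  have hM1 : ε / 16 * P.real univ ≤ ε / 16 := mul_le_of_le_one_right (by positivity) hMle
  have hM2 : e * P.real univ ≤ e := mul_le_of_le_one_right he0.le hMle
  refine ⟨wS, wR, hw, ?_, ?_⟩
  · refine (abs_sub_le _ _ _).trans_lt
      ((add_le_add hwS ((abs_sub_le _ _ _).trans (add_le_add hmixS hSP))).trans_lt ?_)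
    linarith
  · refine (abs_sub_le _ _ _).trans_lt
      ((add_le_add hwR ((abs_sub_le _ _ _).trans (add_le_add hmixR hRP))).trans_lt ?_)
    linarith

end Main

end Disclosure

theorem theorem1 {n : ℕ} (hn : 0 < n)
    (Θ : Set (EuclideanSpace ℝ (Fin n))) (hΘ_compact : IsCompact Θ) (hΘ_convex : Convex ℝ Θ)
    (F : ProbabilityMeasure Θ) (f : EuclideanSpace ℝ (Fin n) → ℝ) (hf_meas : Measurable f)
    (hf_pos : ∀ x ∈ Θ, 0 < f x)
    (hF : (F : Measure Θ).map Subtype.val =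
      (volume.restrict Θ).withDensity (fun x => ENNReal.ofReal (f x)))
    {A : Type*} [MetricSpace A] [CompactSpace A] [MeasurableSpace A] [BorelSpace A]
    (uS uR : A → Θ → ℝ) (hu : Disclosure.RegularPayoffs F uS uR)
    (aStar : Θ → A) (haStar : Disclosure.IsCompleteInfoAction uS uR aStar)
    (h_noRents : Disclosure.NoRents uS uR aStar)
    (h_worstCase : Disclosure.HasWorstCaseTypes uS aStar)
    (h_continuity : Disclosure.ContinuityConditions uS uR)
    (vS vR : ℝ) (h_achievable : Disclosure.Achievable F uS uR vS vR)
    (ε : ℝ) (hε : 0 < ε) :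
    ∃ wS wR : ℝ, Disclosure.Supportable F uS uR wS wR ∧ |wS - vS| < ε ∧ |wR - vR| < ε := by
  have : CompactSpace Θ := isCompact_iff_compactSpace.1 hΘ_compact
  have : Nonempty (Fin n) := ⟨⟨0, hn⟩⟩
  -- The prior is atomless, as it has a density with respect to Lebesgue measure and `0 < n`.
  have : NullSingletonClass (F : Measure Θ) := by
    refine ⟨fun x => ?_⟩
    have h1 : (F : Measure Θ) {x} =
        ((F : Measure Θ).map Subtype.val) {(x : EuclideanSpace ℝ (Fin n))} := by
      rw [Measure.map_apply measurable_subtype_coe (measurableSet_singleton _)]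
      congr 1
      ext y
      simp [Subtype.ext_iff]
    rw [h1, hF]
    refine withDensity_absolutelyContinuous _ _ ?_
    exact Measure.restrict_le_self.absolutelyContinuous (measure_singleton _)
  exact Disclosure.exists_supportable_of_achievable hu haStar h_noRents h_worstCase h_continuity
    h_achievable hε
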